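/- **Lemma (refined Kato inequalities).** Let $M$ be an $n$-dimensional smooth manifold with a Riemannian metric $h$ having Levi-Civita connection $D$, let $k \geq 1$, and let $\phi_{i_1\dots i_k}$ be a smooth completely symmetric covariant $k$-tensor on $M$ that is trace-free ($h^{pq}\phi_{pq i_3 \dots i_k} = 0$; no condition when $k=1$). Inner products and norms of tensors are defined by complete contraction with $h$, parentheses and brackets around indices denote symmetrization and skew-symmetrization (with the factors $1/r!$), and a hat marks an omitted index. Write $$\mathrm{div}(\phi)_{i_1\dots i_{k-1}} = D^p\phi_{p i_1\dots i_{k-1}},$$ $$\mathcal{L}(\phi)_{i_1\dots i_{k+1}} = D_{(i_1}\phi_{i_2\dots i_{k+1})} - \tfrac{k}{n+2(k-1)}\, h_{(i_1i_2}\mathrm{div}(\phi)_{i_3\dots i_{k+1})},$$ $$\mathcal{K}(\phi)_{iji_1\dots i_{k-1}} = D_{[i}\phi_{j]i_1\dots i_{k-1}} - \tfrac{1}{n+k-3}\sum_{s=1}^{k-1} h_{i_s[i}\mathrm{div}(\phi)_{j]i_1\dots \hat{i}_s\dots i_{k-1}}$$ (when $k=1$ the sum is empty, and $\mathcal{K}(\phi)_{ij}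 = D_{[i}\phi_{j]}$; when a denominator vanishes in the remaining cases, $\phi = 0$ and the trace term is $0$). These are the trace-free parts of the symmetrization and of the skew-symmetrization of $D\phi$. A tensor of rank $k+1$ is called pure trace if it is a linear combination of tensors each of which is the product of $h$, in some pair of the indices, with a tensor in the remaining $k-1$ indices. 1. $\mathcal{K}(\phi) = 0$ and $\mathrm{div}(\phi) = 0$ hold on $M$ if and only if $D_{[i}\phi_{j]i_1\dots i_{k-1}} = 0$ and, in the case $k=1$, also $\mathrm{div}(\phi)=0$. If they hold, then wherever $\phi \neq 0$, $$|d|\phi||^2 \leq \tfrac{n+k-2}{n+2(k-1)}\,|D\phi|^2.$$ 2. $\mathcal{L}(\phi) = 0$ and $\mathrm{div}(\phi) = 0$ hold on $M$ if and only if $D_{(i_1}\phi_{i_2\dots i_{k+1})} = 0$. If they hold, then wherever $\phi\neq 0$, $$|d|\phi||^2 \leq \tfrac{k}{k+1}\,|D\phi|^2.$$ 3. $\mathcal{L}(\phi) = 0$ and $\mathcal{K}(\phi) = 0$ hold on $M$ if and only if $D\phi$ is pure trace at every point. If they hold, then wherever $\phi \neq 0$, $$|d|\phi||^2 \leq \tfrac{k}{n+2(k-1)}\,|D\phi|^2.$$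 In each case $|\phi|$ is differentiable at the points where $\phi\neq 0$. -/

import Mathlib

open Bundle Manifold
open scoped ContDiff Manifold InnerProductSpace

namespace KatoTensor

noncomputable section

/-! ### Tensor algebra on a Euclidean vector space

A covariant tensor of rank `r` on `V` is written as a function `T : (Fin r → V) → ℝ` of its `r`
arguments; `T v` is the value on the vectors `v 0, …, v (r - 1)`. Contractions with the metric are
sums over an orthonormal basis. -/

section Algebra

variable {V : Type*} [NormedAddCommGroup V] [InnerProductSpace ℝ V] [FiniteDimensional ℝ V]

/-- The squared norm of a tensor, defined by complete contraction with the metric: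
`|T|² = T_{i₁ … i_r} T^{i₁ … i_r}`. -/
def normSq {r : ℕ} (T : (Fin r → V) → ℝ) : ℝ :=
  ∑ J : Fin r → Fin (Module.finrank ℝ V), T (fun a => stdOrthonormalBasis ℝ V (J a)) ^ 2

/-- The symmetrization `T_{(i₁ … i_r)}`. -/
def symmetrize {r : ℕ} (T : (Fin r → V) → ℝ) : (Fin r → V) → ℝ :=
  fun v => ((Nat.factorial r : ℕ) : ℝ)⁻¹ * ∑ σ : Equiv.Perm (Fin r), T (fun a => v (σ a))

/-- The skew-symmetrization `T_{[ij] i₁ … i_m}` over the first two indices. -/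
def skewFirst {m : ℕ} (T : (Fin (m + 2) → V) → ℝ) : (Fin (m + 2) → V) → ℝ :=
  fun v => (1 / 2) * (T v - T (fun a => v (Equiv.swap 0 1 a)))

/-- Complete symmetry of a tensor. -/
def IsSymm {r : ℕ} (T : (Fin r → V) → ℝ) : Prop :=
  ∀ (σ : Equiv.Perm (Fin r)) (v : Fin r → V), T (fun a => v (σ a)) = T v

/-- Every trace of `T` over a pair of distinct indices vanishes. Tensors of rank at most one
satisfy this vacuously. -/
def IsTraceFree {r : ℕ} (T : (Fin r → V) → ℝ) : Prop :=
  ∀ i j : Fin r, i ≠ j → ∀ v : Fin r → V,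
    ∑ a, T (Function.update (Function.update v i (stdOrthonormalBasis ℝ V a)) j
      (stdOrthonormalBasis ℝ V a)) = 0

/-- `T` is pure trace: a linear combination of tensors each of which is the product of the metric,
in some pair of the indices, with a tensor in the remaining indices. -/
def IsPureTrace {m : ℕ} (T : (Fin (m + 2) → V) → ℝ) : Prop :=
  T ∈ Submodule.span ℝ {f : (Fin (m + 2) → V) → ℝ |
    ∃ (σ : Equiv.Perm (Fin (m + 2))) (τ : MultilinearMap ℝ (fun _ : Fin m => V) ℝ),
      f = fun v => ⟪v (σ 0), v (σ 1)⟫_ℝ * τ (fun a => v (σ a.succ.succ))}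

end Algebra

/-! ### Tensor fields on a Riemannian manifold -/

section Manifold

variable {n : ℕ} {M : Type*} [TopologicalSpace M] [ChartedSpace (EuclideanSpace ℝ (Fin n)) M]

instance instFiniteDimensionalTangentSpace (x : M) :
    FiniteDimensional ℝ (TangentSpace (𝓡 n) x) :=
  inferInstanceAs (FiniteDimensional ℝ (EuclideanSpace ℝ (Fin n)))

/-- A field of covariant tensors of rank `r`. -/
abbrev TensorField (n : ℕ) (M : Type*) [TopologicalSpace M]
    [ChartedSpace (EuclideanSpace ℝ (Fin n)) M] (r : ℕ) : Type _ :=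
  ∀ x : M, MultilinearMap ℝ (fun _ : Fin r => TangentSpace (𝓡 n) x) ℝ

variable [IsManifold (𝓡 n) ∞ M]

/-- A tensor field is smooth if it sends smooth vector fields to smooth functions (all notions
being local). -/
def IsSmooth {r : ℕ} (φ : TensorField n M r) : Prop :=
  ∀ (x : M) (X : Fin r → ∀ y : M, TangentSpace (𝓡 n) y),
    (∀ i, ContMDiffAt (𝓡 n) ((𝓡 n).prod 𝓘(ℝ, EuclideanSpace ℝ (Fin n))) ∞
      (fun y => TotalSpace.mk' (EuclideanSpace ℝ (Fin n)) y (X i y)) x) →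
    ContMDiffAt (𝓡 n) 𝓘(ℝ) ∞ (fun y => φ y (fun i => X i y)) x

variable [RiemannianBundle (fun x : M => TangentSpace (𝓡 n) x)]
  [IsContMDiffRiemannianBundle (𝓡 n) ∞ (EuclideanSpace ℝ (Fin n))
    (fun x : M => TangentSpace (𝓡 n) x)]

instance instRiemannianBundleOne : IsContMDiffRiemannianBundle (𝓡 n) 1 (EuclideanSpace ℝ (Fin n))
    (fun x : M => TangentSpace (𝓡 n) x) :=
  IsContMDiffRiemannianBundle.of_le (n := ∞) (by exact_mod_cast le_top)

/-- `D` is the Levi-Civita connection of the Riemannian metric: the (unique) metric and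
torsion-free covariant derivative on the tangent bundle. -/
def IsLeviCivita (D : CovariantDerivative (𝓡 n) (EuclideanSpace ℝ (Fin n))
    (fun x : M => TangentSpace (𝓡 n) x)) : Prop :=
  D.IsMetricCompatible ∧ D.torsion = 0

/-- Smooth sections of the bundle of trace-free symmetric covariant tensors of rank `r`. -/
structure IsTraceFreeSymmField {r : ℕ} (φ : TensorField n M r) : Prop where
  smooth : IsSmooth φ
  symm : ∀ x, IsSymm (fun v => φ x v)
  traceFree : ∀ x, IsTraceFree (fun v => φ x v)

/-- The pointwise norm `|φ|`. -/
def fieldNorm {r : ℕ} (φ : TensorField n M r) (x : M) : ℝ :=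
  √(normSq (fun v => φ x v))

variable (n) in
/-- The squared norm `|df|²` of the differential of a function. -/
def diffNormSq (f : M → ℝ) (x : M) : ℝ :=
  normSq (fun v : Fin 1 → TangentSpace (𝓡 n) x => mvfderiv (𝓡 n) f x (v 0))

variable (D : CovariantDerivative (𝓡 n) (EuclideanSpace ℝ (Fin n))
    (fun x : M => TangentSpace (𝓡 n) x))

/-- The covariant derivative `(Dφ)_{i i₁ … i_r} = D_i φ_{i₁ … i_r}` of a tensor field; the
differentiation index comes first. It is given by
`(D_X φ)(Y₁, …, Y_r) = X (φ(Y₁, …, Y_r)) - ∑ₛ φ(Y₁, …, D_X Yₛ, …, Y_r)`,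
where the vectors `Yₛ` at `x` are extended to vector fields that are smooth near `x`. -/
def covDeriv {r : ℕ} (φ : TensorField n M r) (x : M) :
    (Fin (r + 1) → TangentSpace (𝓡 n) x) → ℝ :=
  fun v =>
    mvfderiv (𝓡 n) (fun y => φ y (fun s =>
      FiberBundle.extend (EuclideanSpace ℝ (Fin n)) (v s.succ) y)) x (v 0)
    - ∑ s : Fin r, φ x (Function.update (fun t => v t.succ) s
      (D (FiberBundle.extend (EuclideanSpace ℝ (Fin n)) (v s.succ)) x (v 0)))

/-- The divergence `div(φ)_{i₁ … i_m} = D^p φ_{p i₁ … i_m}`. -/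
def divergence {m : ℕ} (φ : TensorField n M (m + 1)) (x : M) :
    (Fin m → TangentSpace (𝓡 n) x) → ℝ :=
  fun w => ∑ a, covDeriv D φ x
    (Fin.cons (stdOrthonormalBasis ℝ (TangentSpace (𝓡 n) x) a)
      (Fin.cons (stdOrthonormalBasis ℝ (TangentSpace (𝓡 n) x) a) w))

/-- For trace-free symmetric `φ` of rank `k = m + 1`, the trace-free part of the symmetrized
covariant derivative:
`D_{(i₁} φ_{i₂ … i_{k+1})} - k / (n + 2 (k - 1)) h_{(i₁ i₂} div(φ)_{i₃ … i_{k+1})}`. -/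
def conformalKilling {m : ℕ} (φ : TensorField n M (m + 1)) (x : M) :
    (Fin (m + 2) → TangentSpace (𝓡 n) x) → ℝ :=
  fun v => symmetrize (covDeriv D φ x) v
    - ((m : ℝ) + 1) / ((n : ℝ) + 2 * m) *
      symmetrize (fun w : Fin (m + 2) → TangentSpace (𝓡 n) x =>
        ⟪w 0, w 1⟫_ℝ * divergence D φ x (fun a => w a.succ.succ)) v

/-- For trace-free symmetric `φ` of rank `k = m + 1`, the trace-free part of the
skew-symmetrized covariant derivative:
`D_{[i} φ_{j] i₁ … i_m} - 1 / (n + k - 3) ∑ₛ h_{iₛ [i} div(φ)_{j] i₁ … îₛ … i_m}`.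
Since `div(φ)` is symmetric, its arguments `j, i₁, …, îₛ, …, i_m` are listed by putting `j` in
the place of `iₛ`. For `k = 1` the sum is empty. -/
def conformalCodazzi {m : ℕ} (φ : TensorField n M (m + 1)) (x : M) :
    (Fin (m + 2) → TangentSpace (𝓡 n) x) → ℝ :=
  fun v => skewFirst (covDeriv D φ x) v
    - 1 / ((n : ℝ) + m - 2) * ∑ s : Fin m, (1 / 2) *
      (⟪v s.succ.succ, v 0⟫_ℝ *
          divergence D φ x (Function.update (fun a => v a.succ.succ) s (v 1))
        - ⟪v s.succ.succ, v 1⟫_ℝ *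
          divergence D φ x (Function.update (fun a => v a.succ.succ) s (v 0)))

end Manifold

end

end KatoTensor

/-! Everything is pointwise algebra once two facts about `A = Dφ` are known. `A` is symmetric and
trace-free in all its slots but the first (`isTFSTail_covComps`), and the derivative of `|φ|²` in
direction `X` is `2⟨D_X φ, φ⟩` (`hasDirDeriv_normSq`). With `ψ = φ` at the point, the second fact
gives `|φ| d|φ|(e_a) = ⟨A(e_a, ·), ψ⟩`, so it suffices to bound `⟨A, ξ ⊗ ψ⟩² ≤ c |A|² |ξ|² |ψ|²` for
all covectors `ξ`; taking for `ξ` the contraction itself yields the Kato constant `c`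
(`sum_sq_le_of_ip_outer_le`, `fieldNorm_kato`).

Arrays such as `A` split orthogonally into three parts, seen by `symTF`, `skewTF` and `tr`. Each
case of the theorem kills two of them, and Cauchy–Schwarz is applied inside the part that is left.
Write `P = |ξ|²|ψ|²` and let `I` be the squared norm of the contraction of `ξ` with `ψ`. By
`ip_outer_swap` the norms of all parts of `ξ ⊗ ψ` are combinations of `P` and `I`, and `|skewTF (ξ ⊗
ψ)|² ≥ 0` gives `(1 + m / (n + m - 2)) I ≤ P` (`IsTFS.ip_tr_outer_le`), where `k = m + 1`. The
symmetric and the pure trace cases use this bound (`kato_of_skew_eq_zero`,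
`kato_of_symTF_skewTF_eq_zero`); the skew case needs only `I ≥ 0` (`kato_of_sym_eq_zero`).

For the equivalences, `A` is the sum of its symmetrization and of permuted copies of its skew part
(`eq_sym_add_sum_skew`), so it is pure trace when both trace-free parts vanish. Conversely, the
trace-free parts of a pure trace tensor are pure trace and totally trace-free, hence orthogonal to
themselves. If the skew part vanishes and `k ≥ 2`, or if the symmetrization vanishes, then the trace
vanishes too. -/

namespace KatoTensor

noncomputable section

set_option linter.unusedSectionVars false
set_option linter.unusedSimpArgs false

/-! ### Arrays of tensor components -/

section Arrays

open Function Equiv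

variable {ι : Type*} {r m : ℕ}

/-- The index tuple `(i, j, w₀, …, w_{m-1})`. -/
def cons₂ (i j : ι) (w : Fin m → ι) : Fin (m + 2) → ι := Fin.cons i (Fin.cons j w)

@[simp] theorem cons₂_zero (i j : ι) (w : Fin m → ι) : cons₂ i j w 0 = i := rfl

@[simp] theorem cons₂_one (i j : ι) (w : Fin m → ι) : cons₂ i j w 1 = j := rfl

@[simp] theorem cons₂_succ_succ (i j : ι) (w : Fin m → ι) (s : Fin m) :
    cons₂ i j w s.succ.succ = w s := rfl

theorem cons₂_eta (J : Fin (m + 2) → ι) : cons₂ (J 0) (J 1) (fun a => J a.succ.succ) = J := by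
  funext a
  refine Fin.cases rfl (fun b => ?_) a
  exact Fin.cases rfl (fun c => rfl) b

theorem fin_cases₂ {P : Fin (m + 2) → Prop} (h0 : P 0) (h1 : P 1) (h : ∀ s : Fin m, P s.succ.succ)
    (p : Fin (m + 2)) : P p :=
  Fin.cases h0 (fun b => Fin.cases h1 h b) p

@[simp] theorem succ_succ_ne_zero (s : Fin m) : s.succ.succ ≠ (0 : Fin (m + 2)) :=
  Fin.succ_ne_zero _

@[simp] theorem succ_succ_ne_one (s : Fin m) : s.succ.succ ≠ (1 : Fin (m + 2)) := by
  rw [← Fin.succ_zero_eq_one]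
  exact fun h => Fin.succ_ne_zero _ (Fin.succ_injective _ h)

theorem cons₂_comp_swap_zero_one (i j : ι) (w : Fin m → ι) :
    cons₂ i j w ∘ swap 0 1 = cons₂ j i w := by
  funext a
  induction a using fin_cases₂ with
  | h0 => simp
  | h1 => simp
  | h s => simp [swap_apply_of_ne_of_ne]

theorem cons₂_comp_swap_zero (i j : ι) (w : Fin m → ι) (s : Fin m) :
    cons₂ i j w ∘ swap 0 s.succ.succ = cons₂ (w s) j (update w s i) := by
  funext a
  induction a using fin_cases₂ with
  | h0 => simp
  | h1 => simp [swap_apply_of_ne_of_ne (a := (0 : Fin (m + 2))) one_ne_zero (succ_succ_ne_one s).symm]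
  | h t =>
    by_cases h : t = s
    · subst h; simp
    · simp [swap_apply_of_ne_of_ne, h]

theorem cons₂_comp_swap_one (i j : ι) (w : Fin m → ι) (s : Fin m) :
    cons₂ i j w ∘ swap 1 s.succ.succ = cons₂ i (w s) (update w s j) := by
  funext a
  induction a using fin_cases₂ with
  | h0 => simp [swap_apply_of_ne_of_ne (a := (1 : Fin (m + 2))) zero_ne_one (succ_succ_ne_zero s).symm]
  | h1 => simp
  | h t =>
    by_cases h : t = s
    · subst h; simp
    · simp [swap_apply_of_ne_of_ne, h]

theorem cons₂_update (i j : ι) (w : Fin m → ι) (s : Fin m) (a : ι) :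
    update (cons₂ i j w) s.succ.succ a = cons₂ i j (update w s a) := by
  rw [cons₂, cons₂, Fin.cons_update, Fin.cons_update]

theorem cons₂_update_zero (i j : ι) (w : Fin m → ι) (a : ι) :
    update (cons₂ i j w) 0 a = cons₂ a j w := Fin.update_cons_zero _ _ _

theorem cons₂_update_one (i j : ι) (w : Fin m → ι) (a : ι) :
    update (cons₂ i j w) 1 a = cons₂ i a w := by
  rw [cons₂, cons₂, ← Fin.succ_zero_eq_one, ← Fin.cons_update, Fin.update_cons_zero]

/-- The action of a permutation of the slots. -/
def permute (σ : Perm (Fin r)) (A : (Fin r → ι) → ℝ) : (Fin r → ι) → ℝ := fun J => A (J ∘ σ)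

theorem permute_permute (σ ρ : Perm (Fin r)) (A : (Fin r → ι) → ℝ) :
    permute σ (permute ρ A) = permute (σ * ρ) A := rfl

/-- Symmetrization of an array. -/
def sym (A : (Fin r → ι) → ℝ) : (Fin r → ι) → ℝ :=
  fun J => ((r.factorial : ℕ) : ℝ)⁻¹ * ∑ σ : Perm (Fin r), A (J ∘ σ)

/-- Skew-symmetrization of an array in the first two slots. -/
def skew (A : (Fin (m + 2) → ι) → ℝ) : (Fin (m + 2) → ι) → ℝ :=
  fun J => (1 / 2) * (A J - A (J ∘ swap 0 1))

theorem permute_sym (σ : Perm (Fin r)) (A : (Fin r → ι) → ℝ) : permute σ (sym A) = sym A := by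
  funext J
  exact congrArg _ (Equiv.sum_comp (Equiv.mulLeft σ) (fun τ => A (J ∘ τ)))

theorem sym_of_forall_permute {A : (Fin r → ι) → ℝ} (h : ∀ σ, permute σ A = A) : sym A = A := by
  funext J
  have : ∀ σ : Perm (Fin r), A (J ∘ σ) = A J := fun σ => congrFun (h σ) J
  unfold sym
  rw [Finset.sum_congr rfl (fun σ _ => this σ), Finset.sum_const, Finset.card_univ,
    Fintype.card_perm, Fintype.card_fin, nsmul_eq_mul, inv_mul_cancel_left₀]
  exact_mod_cast r.factorial_ne_zero

/-- Every permutation is `swap 0 p` times one that fixes `0` (`Perm.decomposeFin`). The second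
factor is absorbed by the tail symmetry, so each `p` contributes `(m + 1)!` equal terms. -/
theorem sym_eq_sum_swap {A : (Fin (m + 2) → ι) → ℝ}
    (hA : ∀ (σ : Perm (Fin (m + 1))) i w, A (Fin.cons i (w ∘ σ)) = A (Fin.cons i w)) :
    sym A = ((m : ℝ) + 2)⁻¹ • ∑ p, permute (swap 0 p) A := by
  funext J
  have key : ∀ (p : Fin (m + 2)) (e : Perm (Fin (m + 1))),
      A (J ∘ Perm.decomposeFin.symm (p, e)) = A (J ∘ swap 0 p) := by
    intro p e
    have h1 : J ∘ Perm.decomposeFin.symm (p, e)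
        = Fin.cons ((J ∘ swap 0 p) 0) ((fun a : Fin (m + 1) => (J ∘ swap 0 p) a.succ) ∘ e) := by
      funext a
      refine Fin.cases ?_ (fun b => ?_) a
      · simp
      · simp [Perm.decomposeFin_symm_apply_succ]
    rw [h1, hA]
    congr 1
    funext a
    exact Fin.cases rfl (fun b => rfl) a
  simp only [sym, Pi.smul_apply, Finset.sum_apply, permute, smul_eq_mul]
  rw [← Equiv.sum_comp Perm.decomposeFin.symm, Fintype.sum_prod_type,
    Finset.sum_congr rfl fun p _ => Finset.sum_congr rfl fun e _ => key p e]
  simp only [Finset.sum_const, Finset.card_univ, Fintype.card_perm, Fintype.card_fin, nsmul_eq_mul,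
    ← Finset.mul_sum]
  rw [← mul_assoc, Nat.factorial_succ (m + 1)]
  congr 1
  have : (((m + 1).factorial : ℕ) : ℝ) ≠ 0 := by exact_mod_cast (m + 1).factorial_ne_zero
  push_cast
  field_simp
  ring

variable [Fintype ι]

/-- The inner product of arrays. -/
def ip (A B : (Fin r → ι) → ℝ) : ℝ := ∑ J, A J * B J

theorem ip_comm (A B : (Fin r → ι) → ℝ) : ip A B = ip B A := by simp only [ip, mul_comm]

theorem ip_add_left (A B C : (Fin r → ι) → ℝ) : ip (A + B) C = ip A C + ip B C := by
  simp [ip, add_mul, Finset.sum_add_distrib]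

theorem ip_sub_left (A B C : (Fin r → ι) → ℝ) : ip (A - B) C = ip A C - ip B C := by
  simp [ip, sub_mul, Finset.sum_sub_distrib]

theorem ip_sub_right (A B C : (Fin r → ι) → ℝ) : ip A (B - C) = ip A B - ip A C := by
  rw [ip_comm, ip_sub_left, ip_comm B, ip_comm C]

theorem ip_smul_left (c : ℝ) (A B : (Fin r → ι) → ℝ) : ip (c • A) B = c * ip A B := by
  simp [ip, mul_assoc, Finset.mul_sum]

theorem ip_smul_right (c : ℝ) (A B : (Fin r → ι) → ℝ) : ip A (c • B) = c * ip A B := by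
  rw [ip_comm, ip_smul_left, ip_comm]

theorem ip_sum_left {κ : Type*} (s : Finset κ) (A : κ → (Fin r → ι) → ℝ) (B : (Fin r → ι) → ℝ) :
    ip (∑ k ∈ s, A k) B = ∑ k ∈ s, ip (A k) B := by
  simp only [ip, Finset.sum_apply, Finset.sum_mul]
  rw [Finset.sum_comm]

theorem ip_zero_left (B : (Fin r → ι) → ℝ) : ip 0 B = 0 := by simp [ip]

theorem ip_self_nonneg (A : (Fin r → ι) → ℝ) : 0 ≤ ip A A :=
  Finset.sum_nonneg fun _ _ => mul_self_nonneg _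

theorem eq_zero_of_ip_self {A : (Fin r → ι) → ℝ} (h : ip A A = 0) : A = 0 := by
  funext J
  have := (Finset.sum_eq_zero_iff_of_nonneg (fun _ _ => mul_self_nonneg _)).1 h J
    (Finset.mem_univ _)
  exact mul_self_eq_zero.1 this

theorem ip_sq_le (A B : (Fin r → ι) → ℝ) : ip A B ^ 2 ≤ ip A A * ip B B := by
  have := Finset.sum_mul_sq_le_sq_mul_sq Finset.univ A B
  simpa only [ip, sq] using this

theorem ip_permute_left (σ : Perm (Fin r)) (A B : (Fin r → ι) → ℝ) :
    ip (permute σ A) B = ip A (permute σ⁻¹ B) := by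
  unfold ip permute
  rw [← Equiv.sum_comp (Equiv.arrowCongr σ (Equiv.refl ι))]
  refine Finset.sum_congr rfl fun J _ => ?_
  congr 2
  funext a
  simp [Equiv.arrowCongr]

theorem ip_sym_left (A B : (Fin r → ι) → ℝ) : ip (sym A) B = ip A (sym B) := by
  have h1 : ∀ A : (Fin r → ι) → ℝ,
      sym A = ((r.factorial : ℕ) : ℝ)⁻¹ • ∑ σ : Perm (Fin r), permute σ A := by
    intro A; funext J; simp [sym, permute]
  rw [h1 A, h1 B, ip_smul_left, ip_smul_right, ip_sum_left, ip_comm A, ip_sum_left,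
    ← Equiv.sum_comp (Equiv.inv (Perm (Fin r)))]
  congr 1
  refine Finset.sum_congr rfl fun σ _ => ?_
  rw [ip_permute_left, ip_comm]
  simp

theorem sum_cons₂ (f : (Fin (m + 2) → ι) → ℝ) :
    ∑ J, f J = ∑ i, ∑ j, ∑ w : Fin m → ι, f (cons₂ i j w) := by
  rw [← Equiv.sum_comp (Fin.consEquiv fun _ => ι), Fintype.sum_prod_type]
  refine Finset.sum_congr rfl fun i _ => ?_
  rw [← Equiv.sum_comp (Fin.consEquiv fun _ => ι), Fintype.sum_prod_type]
  rfl

/-- The trace over the first two slots. -/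
def tr (A : (Fin (m + 2) → ι) → ℝ) : (Fin m → ι) → ℝ := fun w => ∑ a, A (cons₂ a a w)

variable [DecidableEq ι]

/-- The product of the metric, in the first two slots, with an array. -/
def metricMul (d : (Fin m → ι) → ℝ) : (Fin (m + 2) → ι) → ℝ :=
  fun J => (if J 0 = J 1 then 1 else 0) * d (fun a => J a.succ.succ)

theorem metricMul_cons₂ (d : (Fin m → ι) → ℝ) (i j : ι) (w : Fin m → ι) :
    metricMul d (cons₂ i j w) = (if i = j then 1 else 0) * d w := rfl

theorem ip_metricMul (d : (Fin m → ι) → ℝ) (B : (Fin (m + 2) → ι) → ℝ) :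
    ip (metricMul d) B = ip d (tr B) := by
  simp only [ip, sum_cons₂, metricMul_cons₂, tr, ite_mul, one_mul, zero_mul, Finset.mul_sum]
  have h : ∀ i, ∑ j, ∑ w : Fin m → ι, (if i = j then d w * B (cons₂ i j w) else 0)
      = ∑ w, d w * B (cons₂ i i w) := by
    intro i
    rw [Finset.sum_comm]
    simp
  rw [Finset.sum_congr rfl fun i _ => h i, Finset.sum_comm]

theorem swap_one_succ (q b : Fin (m + 1)) :
    swap (1 : Fin (m + 2)) q.succ b.succ = (swap 0 q b).succ := by
  rw [← Fin.succ_zero_eq_one]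
  exact ((Fin.succ_injective (m + 1)).map_swap _ _ _).symm

/-- The coset argument of `sym_eq_sum_swap`, done twice: only the ordered pair of slots that
receives the metric matters, and the symmetry of `d` absorbs the remaining `m!` permutations. -/
theorem sym_metricMul {d : (Fin m → ι) → ℝ} (hd : ∀ (σ : Perm (Fin m)) w, d (w ∘ σ) = d w) :
    sym (metricMul d) = (((m : ℝ) + 1) * ((m : ℝ) + 2))⁻¹ • ∑ p : Fin (m + 2), ∑ q : Fin (m + 1),
      permute (swap 0 p * swap 1 q.succ) (metricMul d) := by
  funext J
  have key : ∀ (p : Fin (m + 2)) (q : Fin (m + 1)) (e : Perm (Fin m)),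
      metricMul d (J ∘ Perm.decomposeFin.symm (p, Perm.decomposeFin.symm (q, e)))
        = metricMul d (J ∘ (swap 0 p * swap 1 q.succ : Perm (Fin (m + 2)))) := by
    intro p q e
    have h0 : Perm.decomposeFin.symm (p, Perm.decomposeFin.symm (q, e)) 0
        = (swap 0 p * swap 1 q.succ) 0 := by
      rw [Perm.decomposeFin_symm_apply_zero, Perm.mul_apply,
        swap_apply_of_ne_of_ne (a := (1 : Fin (m + 2))) zero_ne_one (Fin.succ_ne_zero q).symm,
        swap_apply_left]
    have h1 : Perm.decomposeFin.symm (p, Perm.decomposeFin.symm (q, e)) 1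
        = (swap 0 p * swap 1 q.succ) 1 := by
      rw [← Fin.succ_zero_eq_one, Perm.decomposeFin_symm_apply_succ,
        Perm.decomposeFin_symm_apply_zero, Perm.mul_apply, Fin.succ_zero_eq_one, swap_apply_left]
    have h2 : (fun a : Fin m => J (Perm.decomposeFin.symm (p, Perm.decomposeFin.symm (q, e))
        a.succ.succ)) = (fun a : Fin m => J ((swap 0 p * swap 1 q.succ) a.succ.succ)) ∘ e := by
      funext a
      rw [Perm.decomposeFin_symm_apply_succ, Perm.decomposeFin_symm_apply_succ, Function.comp,
        Perm.mul_apply, swap_one_succ]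
    simp only [metricMul, Function.comp_apply, h0, h1]
    rw [h2, hd]
  simp only [sym, Pi.smul_apply, Finset.sum_apply, permute, smul_eq_mul]
  rw [← Equiv.sum_comp Perm.decomposeFin.symm, Fintype.sum_prod_type]
  have h3 : ∀ p : Fin (m + 2), ∑ e : Perm (Fin (m + 1)), metricMul d (J ∘ Perm.decomposeFin.symm (p, e))
      = (m.factorial : ℝ) * ∑ q : Fin (m + 1),
        metricMul d (J ∘ (swap 0 p * swap 1 q.succ : Perm (Fin (m + 2)))) := by
    intro p
    rw [← Equiv.sum_comp Perm.decomposeFin.symm, Fintype.sum_prod_type, Finset.mul_sum]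
    refine Finset.sum_congr rfl fun q _ => ?_
    rw [Finset.sum_congr rfl fun e _ => key p q e]
    simp [Fintype.card_perm]
  rw [Finset.sum_congr rfl fun p _ => h3 p, ← Finset.mul_sum, ← mul_assoc]
  congr 1
  have : ((m.factorial : ℕ) : ℝ) ≠ 0 := by exact_mod_cast m.factorial_ne_zero
  rw [Nat.factorial_succ, Nat.factorial_succ]
  push_cast
  field_simp
  ring

/-- Arrays that are symmetric and trace-free in all slots but the first, such as the components of
the covariant derivative of a trace-free symmetric tensor. -/
structure IsTFSTail (A : (Fin (m + 2) → ι) → ℝ) : Prop where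
  symm : ∀ (σ : Perm (Fin (m + 1))) i w, A (Fin.cons i (w ∘ σ)) = A (Fin.cons i w)
  tf : ∀ i (w : Fin (m + 1) → ι) p q, p ≠ q →
    ∑ a, A (Fin.cons i (update (update w p a) q a)) = 0

/-- The alternation `½ ∑ₛ (h_{iₛ i} d_{j …} - h_{iₛ j} d_{i …})`. -/
def metricSkew (d : (Fin m → ι) → ℝ) : (Fin (m + 2) → ι) → ℝ :=
  ∑ s : Fin m, (1 / 2 : ℝ) • (permute (swap 0 1 * swap 0 s.succ.succ) (metricMul d)
    - permute (swap 0 s.succ.succ) (metricMul d))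

theorem metricSkew_cons₂ (d : (Fin m → ι) → ℝ) (i j : ι) (w : Fin m → ι) :
    metricSkew d (cons₂ i j w) = ∑ s, (1 / 2 : ℝ) *
      ((if w s = i then 1 else 0) * d (update w s j)
        - (if w s = j then 1 else 0) * d (update w s i)) := by
  simp only [metricSkew, Finset.sum_apply, Pi.smul_apply, Pi.sub_apply, smul_eq_mul, permute,
    Perm.coe_mul, ← Function.comp_assoc, cons₂_comp_swap_zero_one, cons₂_comp_swap_zero,
    metricMul_cons₂]

theorem permute_metricSkew (d : (Fin m → ι) → ℝ) :
    permute (swap 0 1) (metricSkew d) = - metricSkew d := by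
  funext J
  rw [← cons₂_eta J]
  simp only [permute, cons₂_comp_swap_zero_one, metricSkew_cons₂, Pi.neg_apply,
    ← Finset.sum_neg_distrib]
  refine Finset.sum_congr rfl fun s _ => by ring

namespace IsTFSTail

variable {A B : (Fin (m + 2) → ι) → ℝ}

theorem comp_tail (hA : IsTFSTail A) (σ : Perm (Fin m)) (i j : ι) (w : Fin m → ι) :
    A (cons₂ i j (w ∘ σ)) = A (cons₂ i j w) := by
  have h : (Fin.cons j (w ∘ σ) : Fin (m + 1) → ι)
      = Fin.cons j w ∘ Perm.decomposeFin.symm (0, σ) := by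
    funext a
    refine Fin.cases ?_ (fun b => ?_) a
    · simp
    · simp [Perm.decomposeFin_symm_apply_succ]
  rw [cons₂, h, hA.symm, cons₂]

theorem exchange (hA : IsTFSTail A) (i j : ι) (w : Fin m → ι) (s : Fin m) :
    A (cons₂ i (w s) (update w s j)) = A (cons₂ i j w) := by
  have h : (Fin.cons (w s) (update w s j) : Fin (m + 1) → ι)
      = Fin.cons j w ∘ swap 0 s.succ := by
    funext a
    refine Fin.cases ?_ (fun b => ?_) a
    · simp
    · by_cases hb : b = s
      · subst hb; simp
      · simp [swap_apply_of_ne_of_ne, hb]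
  rw [cons₂, h, hA.symm, cons₂]

theorem tr_one (hA : IsTFSTail A) (i : ι) (w : Fin m → ι) (s : Fin m) :
    ∑ a, A (cons₂ i a (update w s a)) = 0 := by
  have := hA.tf i (Fin.cons i w) 0 s.succ (Fin.succ_ne_zero s).symm
  simpa only [cons₂, Fin.update_cons_zero, ← Fin.cons_update] using this

theorem tr_tail (hA : IsTFSTail A) (i j : ι) (w : Fin m → ι) {s t : Fin m} (h : s ≠ t) :
    ∑ a, A (cons₂ i j (update (update w s a) t a)) = 0 := by
  have := hA.tf i (Fin.cons j w) s.succ t.succ (fun h' => h (Fin.succ_injective _ h'))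
  simpa only [cons₂, ← Fin.cons_update] using this

theorem tr_symm (hA : IsTFSTail A) (σ : Perm (Fin m)) (w : Fin m → ι) :
    tr A (w ∘ σ) = tr A w :=
  Finset.sum_congr rfl fun _ _ => hA.comp_tail _ _ _ _

theorem tr_tr (hA : IsTFSTail A) (w : Fin m → ι) {s t : Fin m} (h : s ≠ t) :
    ∑ a, tr A (update (update w s a) t a) = 0 := by
  simp only [tr]
  rw [Finset.sum_comm]
  exact Finset.sum_eq_zero fun i _ => hA.tr_tail _ _ _ h

theorem sym_eq (hA : IsTFSTail A) :
    sym A = ((m : ℝ) + 2)⁻¹ • ∑ p, permute (swap 0 p) A := sym_eq_sum_swap hA.symm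

theorem sym_cons₂ (hA : IsTFSTail A) (i j : ι) (w : Fin m → ι) :
    sym A (cons₂ i j w) = ((m : ℝ) + 2)⁻¹ * (A (cons₂ i j w) + (A (cons₂ j i w)
      + ∑ s, A (cons₂ (w s) j (update w s i)))) := by
  rw [hA.sym_eq]
  simp only [Pi.smul_apply, Pi.add_apply, Finset.sum_apply, smul_eq_mul, permute, Fin.sum_univ_succ,
    Fin.succ_zero_eq_one, cons₂_comp_swap_zero_one, cons₂_comp_swap_zero]
  simp

/-- Of the `m + 2` positions of the first index, the two inside the traced pair give `tr A`; the
others leave a trace over two tail slots, which is zero. -/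
theorem tr_sym (hA : IsTFSTail A) : tr (sym A) = (2 / ((m : ℝ) + 2)) • tr A := by
  funext w
  simp only [tr, hA.sym_cons₂, Pi.smul_apply, smul_eq_mul, ← Finset.mul_sum,
    Finset.sum_add_distrib]
  rw [Finset.sum_comm (f := fun a s => A (cons₂ (w s) a (update w s a))),
    Finset.sum_eq_zero (f := fun s => ∑ a, A (cons₂ (w s) a (update w s a)))
      fun s _ => hA.tr_one _ _ _]
  ring

/-- Count ordered pairs of slots carrying the metric by their overlap with the traced pair: two
pairs coincide with it and give `n` each, `4m` share one slot and give `1` each, and the disjoint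
ones give a double trace, zero by `tr_tr`. The total is `2n + 4m`. -/
theorem tr_sym_metricMul (hA : IsTFSTail A) :
    tr (sym (metricMul (tr A))) =
      (2 * ((Fintype.card ι : ℝ) + 2 * m) / (((m : ℝ) + 1) * ((m : ℝ) + 2))) • tr A := by
  funext w
  have key : ∀ s t : Fin m, ∑ a, (if w s = update w s a t then (1 : ℝ) else 0)
      * tr A (update (update w s a) t a) = if t = s then tr A w else 0 := by
    intro s t
    by_cases h : t = s
    · subst h
      simp
    · simp only [update_of_ne h, h, if_false, ← Finset.mul_sum, hA.tr_tr w (Ne.symm h), mul_zero]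
  rw [sym_metricMul hA.tr_symm, tr]
  simp only [Pi.smul_apply, Pi.add_apply, Finset.sum_apply, smul_eq_mul, permute, Fin.sum_univ_succ,
    Fin.succ_zero_eq_one, cons₂_comp_swap_zero_one, cons₂_comp_swap_zero, cons₂_comp_swap_one,
    Perm.coe_mul, ← Function.comp_assoc, metricMul_cons₂, swap_self, Equiv.coe_refl,
    Function.comp_id, ← Finset.mul_sum, Finset.sum_add_distrib]
  have k1 : ∑ x, ∑ s : Fin m, (if w s = x then (1 : ℝ) else 0) * tr A (update w s x)
      = m * tr A w := by
    rw [Finset.sum_comm]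
    simp
  have k2 : ∑ x, ∑ s : Fin m, (if x = w s then (1 : ℝ) else 0) * tr A (update w s x)
      = m * tr A w := by
    rw [Finset.sum_comm]
    simp
  have k3 : ∑ x, ∑ s : Fin m, ∑ t : Fin m, (if w s = update w s x t then (1 : ℝ) else 0)
      * tr A (update (update w s x) t x) = m * tr A w := by
    rw [Finset.sum_comm]
    simp only [Finset.sum_comm (s := (Finset.univ : Finset ι)), key]
    simp
  rw [k1, k2, k3]
  simp only [if_true, one_mul, Finset.sum_const, Finset.card_univ, nsmul_eq_mul]
  field_simp
  ring

end IsTFSTail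

end Arrays

/-! ### Trace-free parts, pure trace arrays and their orthogonality -/

section TraceFreeParts

open Function Equiv

variable {ι : Type*} {r m : ℕ}

theorem permute_swap_of_tail_symm {A : (Fin (m + 2) → ι) → ℝ}
    (hA : ∀ (σ : Perm (Fin (m + 1))) i w, A (Fin.cons i (w ∘ σ)) = A (Fin.cons i w))
    (q : Fin (m + 1)) : permute (swap 1 q.succ) A = A := by
  funext J
  have h : J ∘ swap 1 q.succ = Fin.cons (J 0) ((fun a : Fin (m + 1) => J a.succ) ∘ swap 0 q) := by
    funext a
    refine Fin.cases ?_ (fun b => ?_) a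
    · simp [swap_apply_of_ne_of_ne (a := (1 : Fin (m + 2))) zero_ne_one (Fin.succ_ne_zero q).symm]
    · simp [swap_one_succ]
  rw [permute, h, hA]
  congr 1
  funext a
  exact Fin.cases rfl (fun b => rfl) a

/-- Conjugation of `swap 0 1` by `swap 1 q.succ`; the inner conjugating factor acts trivially by
tail symmetry. -/
theorem permute_swap_zero_of_tail_symm {A : (Fin (m + 2) → ι) → ℝ}
    (hA : ∀ (σ : Perm (Fin (m + 1))) i w, A (Fin.cons i (w ∘ σ)) = A (Fin.cons i w))
    (q : Fin (m + 1)) :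
    permute (swap 0 q.succ) A = permute (swap 1 q.succ) (permute (swap 0 1) A) := by
  refine Fin.cases ?_ (fun s => ?_) q
  · rw [Fin.succ_zero_eq_one, swap_self]
    rfl
  · have h := swap_mul_swap_mul_swap (x := (0 : Fin (m + 2))) (y := 1) (z := s.succ.succ)
      zero_ne_one (succ_succ_ne_zero s).symm
    rw [swap_comm, ← h, ← permute_permute, ← permute_permute, permute_swap_of_tail_symm hA]

/-- A tensor that is symmetric in all slots but the first is the sum of its symmetrization and of
permutations of its skew-symmetrization. -/
theorem eq_sym_add_sum_skew {A : (Fin (m + 2) → ι) → ℝ}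
    (hA : ∀ (σ : Perm (Fin (m + 1))) i w, A (Fin.cons i (w ∘ σ)) = A (Fin.cons i w)) :
    A = sym A + (2 / ((m : ℝ) + 2)) • ∑ q : Fin (m + 1), permute (swap 1 q.succ) (skew A) := by
  -- Since `permute (swap 0 1) A = A - 2 skew A`, each transposition with the first slot changes `A`
  -- by a permuted skew part; averaging over the transpositions compares `sym A` with `A`.
  have h : ∀ q : Fin (m + 1), permute (swap 0 q.succ) A
      = A - (2 : ℝ) • permute (swap 1 q.succ) (skew A) := by
    intro q
    have h1 : permute (swap 0 1) A = A - (2 : ℝ) • skew A := by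
      funext J
      simp only [permute, skew, Pi.sub_apply, Pi.smul_apply, smul_eq_mul]
      ring
    rw [permute_swap_zero_of_tail_symm hA, h1]
    exact congrArg (· - (2 : ℝ) • permute (swap 1 q.succ) (skew A)) (permute_swap_of_tail_symm hA q)
  rw [sym_eq_sum_swap hA, Fin.sum_univ_succ, Finset.sum_congr rfl fun q _ => h q,
    Finset.sum_sub_distrib, ← Finset.smul_sum, swap_self]
  funext J
  have : permute (Equiv.refl (Fin (m + 2))) A = A := rfl
  simp only [this, Pi.add_apply, Pi.sub_apply, Pi.smul_apply, Finset.sum_const, Finset.card_univ,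
    Fintype.card_fin, smul_eq_mul, nsmul_eq_mul, Pi.mul_apply, Pi.natCast_apply]
  push_cast
  field_simp
  ring

variable [Fintype ι]

theorem tr_sub (A B : (Fin (m + 2) → ι) → ℝ) : tr (A - B) = tr A - tr B := by
  funext w
  simp [tr]

theorem tr_smul (c : ℝ) (A : (Fin (m + 2) → ι) → ℝ) : tr (c • A) = c • tr A := by
  funext w
  simp [tr, Finset.mul_sum]

theorem ip_skew_left (A B : (Fin (m + 2) → ι) → ℝ) :
    ip (skew A) B = (1 / 2) * (ip A B - ip A (permute (swap 0 1) B)) := by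
  have h : skew A = (1 / 2 : ℝ) • (A - permute (swap 0 1) A) := rfl
  rw [h, ip_smul_left, ip_sub_left, ip_permute_left, swap_inv]

theorem ip_skew_right_of_permute {X : (Fin (m + 2) → ι) → ℝ} (hX : permute (swap 0 1) X = -X)
    (B : (Fin (m + 2) → ι) → ℝ) : ip X (skew B) = ip X B := by
  have h : ip X (permute (swap 0 1) B) = - ip X B := by
    rw [← swap_inv, ← ip_permute_left, hX, ← neg_one_smul ℝ X, ip_smul_left, neg_one_mul]
  rw [ip_comm, ip_skew_left, ip_comm B, ip_comm B, ip_permute_left, swap_inv, h]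
  ring

variable [DecidableEq ι]

theorem IsTFSTail.tr_update_update {A : (Fin (m + 2) → ι) → ℝ} (hA : IsTFSTail A) (w : Fin m → ι)
    {s t : Fin m} (h : s ≠ t) (a b : ι) :
    tr A (update (update w s a) t b) = tr A (update (update w s b) t a) := by
  rw [← hA.tr_symm (swap s t)]
  congr 1
  funext c
  by_cases hc : c = s
  · subst hc; simp [h]
  · by_cases hc' : c = t
    · subst hc'; simp [h]
    · simp [swap_apply_of_ne_of_ne, hc, hc']

theorem ip_sym_metricMul {B : (Fin (m + 2) → ι) → ℝ} (hB : IsTFSTail B) (d : (Fin m → ι) → ℝ) :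
    ip (sym (metricMul d)) B = 2 / ((m : ℝ) + 2) * ip d (tr B) := by
  rw [ip_sym_left, ip_metricMul, hB.tr_sym, ip_smul_right]

/-- In each summand one term contracts the first slot of `B` with a tail slot, giving `tr B`, and
the other contracts two tail slots, giving zero. -/
theorem ip_metricSkew {B : (Fin (m + 2) → ι) → ℝ} (hB : IsTFSTail B) (d : (Fin m → ι) → ℝ) :
    ip (metricSkew d) B = (m : ℝ) / 2 * ip d (tr B) := by
  have h1 : ∀ s : Fin m, tr (permute (swap 0 s.succ.succ * swap 0 1) B) = tr B := by
    intro s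
    funext w
    simp only [tr, permute, Perm.coe_mul, ← Function.comp_assoc, cons₂_comp_swap_zero,
      cons₂_comp_swap_zero_one, hB.exchange]
  have h2 : ∀ s : Fin m, tr (permute (swap 0 s.succ.succ) B) = 0 := by
    intro s
    funext w
    simp only [tr, permute, cons₂_comp_swap_zero, hB.tr_one, Pi.zero_apply]
  have h3 : ip d (0 : (Fin m → ι) → ℝ) = 0 := by rw [ip_comm, ip_zero_left]
  simp only [metricSkew, ip_sum_left, ip_smul_left, ip_sub_left, ip_permute_left, mul_inv_rev,
    swap_inv, ip_metricMul, h1, h2, h3, Finset.sum_const, Finset.card_univ, Fintype.card_fin,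
    nsmul_eq_mul]
  ring

/-- By tail symmetry of both arrays, all `m + 1` transpositions of the first slot with a tail slot
have the same pairing. -/
theorem ip_sym {B : (Fin (m + 2) → ι) → ℝ} (A : (Fin (m + 2) → ι) → ℝ) (hA : IsTFSTail A)
    (hB : IsTFSTail B) :
    ip (sym A) B = ((m : ℝ) + 2)⁻¹ * (ip A B + ((m : ℝ) + 1) * ip A (permute (swap 0 1) B)) := by
  have h : ∀ q : Fin (m + 1), ip B (permute (swap 0 q.succ) A) = ip A (permute (swap 0 1) B) := by
    intro q
    rw [permute_swap_zero_of_tail_symm hA.symm, ← swap_inv (1 : Fin (m + 2)) q.succ,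
      ← ip_permute_left, permute_swap_of_tail_symm hB.symm, ip_comm, ip_permute_left, swap_inv]
  rw [hA.sym_eq, ip_smul_left, ip_sum_left, Fin.sum_univ_succ, swap_self]
  congr 2
  rw [Finset.sum_congr rfl fun q _ => (ip_comm _ _).trans (h q)]
  simp

/-- The trace-free part of the symmetrization. -/
def symTF (A : (Fin (m + 2) → ι) → ℝ) : (Fin (m + 2) → ι) → ℝ :=
  sym A - (((m : ℝ) + 1) / ((Fintype.card ι : ℝ) + 2 * m)) • sym (metricMul (tr A))

/-- The trace-free part of the skew-symmetrization. -/
def skewTF (A : (Fin (m + 2) → ι) → ℝ) : (Fin (m + 2) → ι) → ℝ :=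
  skew A - (1 / ((Fintype.card ι : ℝ) + m - 2)) • metricSkew (tr A)

theorem permute_symTF (σ : Perm (Fin (m + 2))) (A : (Fin (m + 2) → ι) → ℝ) :
    permute σ (symTF A) = symTF A := by
  have h : permute σ (symTF A) = permute σ (sym A) - (((m : ℝ) + 1) /
    ((Fintype.card ι : ℝ) + 2 * m)) • permute σ (sym (metricMul (tr A))) := rfl
  rw [h, permute_sym, permute_sym, symTF]

theorem permute_skewTF (A : (Fin (m + 2) → ι) → ℝ) :
    permute (swap 0 1) (skewTF A) = - skewTF A := by
  have h : permute (swap 0 1) (skewTF A) = permute (swap 0 1) (skew A) - (1 /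
    ((Fintype.card ι : ℝ) + m - 2)) • permute (swap 0 1) (metricSkew (tr A)) := rfl
  have h2 : permute (swap 0 1) (skew A) = - skew A := by
    funext J
    simp only [permute, skew, Function.comp_assoc, Pi.neg_apply, ← Perm.coe_mul, swap_mul_self,
      Perm.coe_one, Function.comp_id]
    ring
  rw [h, permute_metricSkew, h2, skewTF]
  module

theorem tr_symTF {A : (Fin (m + 2) → ι) → ℝ} (hA : IsTFSTail A)
    (hn : (Fintype.card ι : ℝ) + 2 * m ≠ 0) : tr (symTF A) = 0 := by
  rw [symTF, tr_sub, tr_smul, hA.tr_sym, hA.tr_sym_metricMul, smul_smul, ← sub_smul]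
  have : 2 / ((m : ℝ) + 2) - ((m : ℝ) + 1) / ((Fintype.card ι : ℝ) + 2 * m) *
      (2 * ((Fintype.card ι : ℝ) + 2 * m) / (((m : ℝ) + 1) * ((m : ℝ) + 2))) = 0 := by
    field_simp
    ring
  rw [this, zero_smul]

/-- All traces of `A` over a pair of distinct slots vanish. -/
def AllTracesZero (A : (Fin r → ι) → ℝ) : Prop :=
  ∀ p q, p ≠ q → ∀ u : Fin r → ι, ∑ a, A (update (update u p a) q a) = 0

/-- Skewness in the first two slots makes the trace over them vanish and exchanges the pairs `(0,
s)` and `(1, s)`, so only two types of pairs need checking. -/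
theorem allTracesZero_of_cons₂ {X : (Fin (m + 2) → ι) → ℝ}
    (hX : permute (swap 0 1) X = -X)
    (h0 : ∀ i w (s : Fin m), ∑ a, X (cons₂ a i (update w s a)) = 0)
    (h1 : ∀ i j w (s t : Fin m), s ≠ t → ∑ a, X (cons₂ i j (update (update w s a) t a)) = 0) :
    AllTracesZero X := by
  have hX' : ∀ i j w, X (cons₂ i j w) = - X (cons₂ j i w) := by
    intro i j w
    have := congrFun hX (cons₂ j i w)
    rwa [permute, cons₂_comp_swap_zero_one] at this
  have h01 : ∀ w, ∑ a, X (cons₂ a a w) = 0 :=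
    fun w => Finset.sum_eq_zero fun a _ => by linarith [hX' a a w]
  have h0' : ∀ i w (s : Fin m), ∑ a, X (cons₂ i a (update w s a)) = 0 := by
    intro i w s
    rw [Finset.sum_congr rfl fun a _ => hX' i a _, Finset.sum_neg_distrib, h0, neg_zero]
  intro p q hpq u
  rw [← cons₂_eta u]
  induction p using fin_cases₂ with
  | h0 =>
    induction q using fin_cases₂ with
    | h0 => exact absurd rfl hpq
    | h1 => simpa only [cons₂_update_zero, cons₂_update_one] using h01 _
    | h s => simpa only [cons₂_update_zero, cons₂_update] using h0 _ _ _
  | h1 =>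
    induction q using fin_cases₂ with
    | h0 => simpa only [cons₂_update_zero, cons₂_update_one] using h01 _
    | h1 => exact absurd rfl hpq
    | h s => simpa only [cons₂_update_one, cons₂_update] using h0' _ _ _
  | h t =>
    induction q using fin_cases₂ with
    | h0 => simpa only [cons₂_update_zero, cons₂_update] using h0 _ _ _
    | h1 => simpa only [cons₂_update_one, cons₂_update] using h0' _ _ _
    | h s => simpa only [cons₂_update] using h1 _ _ _ _ _ fun h => hpq (by rw [h])

theorem allTracesZero_skewTF {A : (Fin (m + 2) → ι) → ℝ} (hA : IsTFSTail A)
    (hn : m ≠ 0 → (Fintype.card ι : ℝ) + m - 2 ≠ 0) : AllTracesZero (skewTF A) := by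
  refine allTracesZero_of_cons₂ (permute_skewTF A) (fun j w s => ?_) (fun i j w s t hst => ?_)
  -- Trace over the first slot and a tail slot. That of `skew A` is half a value of `tr A`. In that
  -- of `metricSkew (tr A)`, the sums `keyA` contribute `n + (m - 1)` and `keyB` subtracts `1`, so
  -- it is `(n + m - 2) / 2` times the same value: this is where the coefficient in `skewTF` comes
  -- from.
  · have hm : (Fintype.card ι : ℝ) + m - 2 ≠ 0 := hn (Fin.pos s).ne'
    have e1 : ∑ a, A (cons₂ a j (update w s a)) = tr A (update w s j) := by
      refine Finset.sum_congr rfl fun a _ => ?_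
      have := hA.exchange a a (update w s j) s
      rwa [update_self, update_idem] at this
    have keyA : ∀ t : Fin m, ∑ a, (if update w s a t = a then (1 : ℝ) else 0) *
        tr A (update (update w s a) t j) = tr A (update w s j) + if t = s
          then ((Fintype.card ι : ℝ) - 1) * tr A (update w s j) else 0 := by
      intro t
      by_cases h : t = s
      · subst h
        simp
        ring
      · have h4 : tr A (update (update w s (w t)) t j) = tr A (update w s j) := by
          rw [hA.tr_update_update w (Ne.symm h), update_eq_self_iff.2]
          simp [h]
        simp [update_of_ne h, h, h4]
    have keyB : ∀ t : Fin m, ∑ a, (if update w s a t = j then (1 : ℝ) else 0) *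
        tr A (update (update w s a) t a) = if t = s then tr A (update w s j) else 0 := by
      intro t
      by_cases h : t = s
      · subst h
        simp
      · simp only [update_of_ne h, h, if_false, ← Finset.mul_sum, hA.tr_tr w (Ne.symm h), mul_zero]
    simp only [skewTF, skew, Pi.sub_apply, Pi.smul_apply, smul_eq_mul, Finset.sum_sub_distrib,
      cons₂_comp_swap_zero_one, metricSkew_cons₂, ← Finset.mul_sum, e1, hA.tr_one]
    simp only [Finset.sum_comm (s := (Finset.univ : Finset ι)), keyA, keyB]
    simp [Finset.sum_add_distrib]
    field_simp
    ring
  -- Trace over two tail slots: the result is symmetric in `i` and `j`, so the alternation cancels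
  -- it.
  · have keyF : ∀ i j (u : Fin m), ∑ a, (if update (update w s a) t a u = i then (1 : ℝ) else 0) *
        tr A (update (update (update w s a) t a) u j) = if u = s ∨ u = t then
          tr A (update (update w s i) t j) else 0 := by
      intro i j u
      by_cases h : u = t
      · subst h
        simp
      by_cases h' : u = s
      · subst h'
        simp [h, update_comm h]
        exact hA.tr_update_update w (Ne.symm h) _ _
      · simp only [update_of_ne h, update_of_ne h', h, h', or_self, if_false, ← Finset.mul_sum]
        simp only [update_comm (Ne.symm h), update_comm (Ne.symm h'), hA.tr_tr _ hst, mul_zero]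
    simp only [skewTF, skew, Pi.sub_apply, Pi.smul_apply, smul_eq_mul, Finset.sum_sub_distrib,
      cons₂_comp_swap_zero_one, metricSkew_cons₂, ← Finset.mul_sum, hA.tr_tail _ _ _ hst]
    simp only [Finset.sum_comm (s := (Finset.univ : Finset ι)), keyF, hA.tr_update_update w hst j i]
    simp

/-- The span of the products of the metric, in some pair of the slots, with another array. -/
def pureTrace (ι : Type*) [DecidableEq ι] (m : ℕ) : Submodule ℝ ((Fin (m + 2) → ι) → ℝ) :=
  Submodule.span ℝ {f | ∃ (σ : Perm (Fin (m + 2))) (τ : (Fin m → ι) → ℝ),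
    f = permute σ (metricMul τ)}

theorem permute_metricMul_mem (σ : Perm (Fin (m + 2))) (τ : (Fin m → ι) → ℝ) :
    permute σ (metricMul τ) ∈ pureTrace ι m := Submodule.subset_span ⟨σ, τ, rfl⟩

theorem metricMul_mem (τ : (Fin m → ι) → ℝ) : metricMul τ ∈ pureTrace ι m :=
  permute_metricMul_mem 1 τ

theorem permute_mem_pureTrace {A : (Fin (m + 2) → ι) → ℝ} (hA : A ∈ pureTrace ι m)
    (σ : Perm (Fin (m + 2))) : permute σ A ∈ pureTrace ι m := by
  induction hA using Submodule.span_induction with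
  | mem x hx =>
    obtain ⟨ρ, τ, rfl⟩ := hx
    exact permute_metricMul_mem (σ * ρ) τ
  | zero => exact zero_mem _
  | add x y _ _ hx hy => exact add_mem hx hy
  | smul c x _ hx => exact Submodule.smul_mem _ c hx

theorem sym_mem_pureTrace {A : (Fin (m + 2) → ι) → ℝ} (hA : A ∈ pureTrace ι m) :
    sym A ∈ pureTrace ι m := by
  have h : sym A = (((m + 2).factorial : ℕ) : ℝ)⁻¹ • ∑ σ : Perm (Fin (m + 2)), permute σ A := by
    funext J; simp [sym, permute]
  rw [h]
  exact Submodule.smul_mem _ _ (Submodule.sum_mem _ fun σ _ => permute_mem_pureTrace hA σ)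

theorem symTF_mem_pureTrace {A : (Fin (m + 2) → ι) → ℝ} (hA : A ∈ pureTrace ι m) :
    symTF A ∈ pureTrace ι m :=
  sub_mem (sym_mem_pureTrace hA)
    (Submodule.smul_mem _ _ (sym_mem_pureTrace (metricMul_mem _)))

theorem metricSkew_mem_pureTrace (d : (Fin m → ι) → ℝ) : metricSkew d ∈ pureTrace ι m :=
  Submodule.sum_mem _ fun _ _ => Submodule.smul_mem _ _
    (sub_mem (permute_metricMul_mem _ _) (permute_metricMul_mem _ _))

theorem skewTF_mem_pureTrace {A : (Fin (m + 2) → ι) → ℝ} (hA : A ∈ pureTrace ι m) :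
    skewTF A ∈ pureTrace ι m :=
  sub_mem (Submodule.smul_mem _ (1 / 2 : ℝ) (sub_mem hA (permute_mem_pureTrace hA (swap 0 1))))
    (Submodule.smul_mem _ _ (metricSkew_mem_pureTrace _))

/-- Pairing `X` with a permuted product of the metric and `τ` is the same as pairing `τ` with a
trace of `X` over some pair of slots. -/
theorem ip_eq_zero_of_mem_pureTrace {P X : (Fin (m + 2) → ι) → ℝ} (hP : P ∈ pureTrace ι m)
    (hX : AllTracesZero X) : ip P X = 0 := by
  induction hP using Submodule.span_induction with
  | mem x hx =>
    obtain ⟨σ, τ, rfl⟩ := hx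
    rw [ip_permute_left, ip_metricMul]
    have h : tr (permute σ⁻¹ X) = 0 := by
      funext w
      rcases isEmpty_or_nonempty ι with hι | ⟨⟨b⟩⟩
      · simp [tr]
      · have h1 : ∀ a, cons₂ a a w ∘ ⇑σ⁻¹
            = update (update (cons₂ b b w ∘ ⇑σ⁻¹) (σ 0) a) (σ 1) a := by
          intro a
          have h2 : cons₂ a a w = update (update (cons₂ b b w) 0 a) 1 a := by
            rw [cons₂_update_zero, cons₂_update_one]
          rw [h2, update_comp_equiv, update_comp_equiv]
          rfl
        exact (Finset.sum_congr rfl fun a _ => congrArg X (h1 a)).trans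
          (hX _ _ (fun h => zero_ne_one (σ.injective h)) _)
    rw [h, ip_comm, ip_zero_left]
  | zero => exact ip_zero_left _
  | add x y _ _ hx hy => rw [ip_add_left, hx, hy, add_zero]
  | smul c x _ hx => rw [ip_smul_left, hx, mul_zero]

theorem allTracesZero_of_permute {X : (Fin (m + 2) → ι) → ℝ} (hX : ∀ σ, permute σ X = X)
    (h : tr X = 0) : AllTracesZero X := by
  intro p q hpq u
  obtain ⟨σ, h0, h1⟩ : ∃ σ : Perm (Fin (m + 2)), σ 0 = p ∧ σ 1 = q := by
    -- `swap 0 p` sends `0` to `p`; the outer factor then moves the image of `1` to `q` and fixes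
    -- `p`.
    refine ⟨swap (swap 0 p 1) q * swap 0 p, ?_, ?_⟩
    · rw [Perm.mul_apply, swap_apply_left, swap_apply_of_ne_of_ne _ hpq]
      intro h
      have := congrArg (swap 0 p) h
      rw [swap_apply_right, swap_apply_self] at this
      exact zero_ne_one this
    · rw [Perm.mul_apply, swap_apply_left]
  have key : ∀ a, X (update (update u p a) q a)
      = X (cons₂ a a (fun s => u (σ s.succ.succ))) := by
    intro a
    rw [← congrFun (hX σ) (update (update u p a) q a), permute]
    congr 1
    rw [← cons₂_eta (update (update u p a) q a ∘ σ)]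
    have e0 : (update (update u p a) q a ∘ σ) 0 = a := by simp [h0, hpq]
    have e1 : (update (update u p a) q a ∘ σ) 1 = a := by simp [h1]
    rw [e0, e1]
    congr 1
    funext s
    have n0 : σ s.succ.succ ≠ p := by
      rw [← h0]; exact fun h => succ_succ_ne_zero s (σ.injective h)
    have n1 : σ s.succ.succ ≠ q := by
      rw [← h1]; exact fun h => succ_succ_ne_one s (σ.injective h)
    simp [n0, n1]
  rw [Finset.sum_congr rfl fun a _ => key a]
  exact congrFun h _

theorem allTracesZero_symTF {A : (Fin (m + 2) → ι) → ℝ} (hA : IsTFSTail A)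
    (hn : (Fintype.card ι : ℝ) + 2 * m ≠ 0) : AllTracesZero (symTF A) :=
  allTracesZero_of_permute (fun σ => permute_symTF σ A) (tr_symTF hA hn)

theorem symTF_eq_zero {A : (Fin (m + 2) → ι) → ℝ} (hA : IsTFSTail A)
    (hn : (Fintype.card ι : ℝ) + 2 * m ≠ 0) (h : A ∈ pureTrace ι m) : symTF A = 0 :=
  eq_zero_of_ip_self
    (ip_eq_zero_of_mem_pureTrace (symTF_mem_pureTrace h) (allTracesZero_symTF hA hn))

theorem skewTF_eq_zero {A : (Fin (m + 2) → ι) → ℝ} (hA : IsTFSTail A)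
    (hn : m ≠ 0 → (Fintype.card ι : ℝ) + m - 2 ≠ 0) (h : A ∈ pureTrace ι m) : skewTF A = 0 :=
  eq_zero_of_ip_self
    (ip_eq_zero_of_mem_pureTrace (skewTF_mem_pureTrace h) (allTracesZero_skewTF hA hn))

/-- The trace correction is orthogonal to `symTF B` and `sym` is self-adjoint, so the square equals
`ip (symTF B) B`, which is linear in the trace term. -/
theorem ip_symTF_self {B : (Fin (m + 2) → ι) → ℝ} (hB : IsTFSTail B)
    (hn : (Fintype.card ι : ℝ) + 2 * m ≠ 0) :
    ip (symTF B) (symTF B) = ((m : ℝ) + 2)⁻¹ *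
      (ip B B + ((m : ℝ) + 1) * ip B (permute (swap 0 1) B))
      - ((m : ℝ) + 1) / ((Fintype.card ι : ℝ) + 2 * m) * (2 / ((m : ℝ) + 2) *
        ip (tr B) (tr B)) := by
  have h1 : ip (symTF B) (symTF B) = ip (symTF B) (sym B) := by
    conv_lhs => arg 2; rw [symTF]
    rw [ip_sub_right, ip_smul_right, ip_comm (symTF B) (sym (metricMul _)),
      ip_eq_zero_of_mem_pureTrace (sym_mem_pureTrace (metricMul_mem _))
        (allTracesZero_symTF hB hn), mul_zero, sub_zero]
  have h2 : sym (symTF B) = symTF B := sym_of_forall_permute fun σ => permute_symTF σ B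
  rw [h1, ← ip_sym_left, h2, symTF, ip_sub_left, ip_smul_left, ip_sym B hB hB,
    ip_sym_metricMul hB]

theorem ip_skewTF {A B : (Fin (m + 2) → ι) → ℝ} (hB : IsTFSTail B) :
    ip (skewTF A) B = (1 / 2) * (ip A B - ip A (permute (swap 0 1) B))
      - 1 / ((Fintype.card ι : ℝ) + m - 2) * ((m : ℝ) / 2 * ip (tr A) (tr B)) := by
  rw [skewTF, ip_sub_left, ip_smul_left, ip_skew_left, ip_metricSkew hB]

theorem ip_symTF {A B : (Fin (m + 2) → ι) → ℝ} (hA : IsTFSTail A) (hB : IsTFSTail B) :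
    ip (symTF A) B = ((m : ℝ) + 2)⁻¹ *
      (ip A B + ((m : ℝ) + 1) * ip A (permute (swap 0 1) B))
      - ((m : ℝ) + 1) / ((Fintype.card ι : ℝ) + 2 * m) * (2 / ((m : ℝ) + 2) *
        ip (tr A) (tr B)) := by
  rw [symTF, ip_sub_left, ip_smul_left, ip_sym A hA hB, ip_sym_metricMul hB]

/-- The expression is `ip (skewTF B) (skewTF B)`, by the same orthogonality as in `ip_symTF_self`.
It is the source of the bound on contractions. -/
theorem ip_skewTF_self_nonneg {B : (Fin (m + 2) → ι) → ℝ} (hB : IsTFSTail B)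
    (hn : m ≠ 0 → (Fintype.card ι : ℝ) + m - 2 ≠ 0) :
    0 ≤ (1 / 2) * (ip B B - ip B (permute (swap 0 1) B))
      - 1 / ((Fintype.card ι : ℝ) + m - 2) * ((m : ℝ) / 2 * ip (tr B) (tr B)) := by
  have h1 : ip (skewTF B) (skewTF B) = ip (skewTF B) (skew B) := by
    conv_lhs => arg 2; rw [skewTF]
    rw [ip_sub_right, ip_smul_right, ip_comm (skewTF B) (metricSkew _),
      ip_eq_zero_of_mem_pureTrace (metricSkew_mem_pureTrace _)
        (allTracesZero_skewTF hB hn), mul_zero, sub_zero]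
  rw [← ip_skewTF hB, ← ip_skew_right_of_permute (permute_skewTF B), ← h1]
  exact ip_self_nonneg _

end TraceFreeParts

/-! ### The three algebraic Kato inequalities -/

section KatoArrays

open Function Equiv

variable {ι : Type*} {m : ℕ}

/-- The tensor product of a covector with an array. -/
def outer (ξ : ι → ℝ) (ψ : (Fin (m + 1) → ι) → ℝ) : (Fin (m + 2) → ι) → ℝ :=
  fun J => ξ (J 0) * ψ (fun a => J a.succ)

theorem outer_cons (ξ : ι → ℝ) (ψ : (Fin (m + 1) → ι) → ℝ) (i : ι) (K : Fin (m + 1) → ι) :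
    outer ξ ψ (Fin.cons i K) = ξ i * ψ K := rfl

variable [Fintype ι]

theorem sum_cons (f : (Fin (m + 1) → ι) → ℝ) : ∑ J, f J = ∑ i, ∑ K : Fin m → ι, f (Fin.cons i K) := by
  rw [← Equiv.sum_comp (Fin.consEquiv fun _ => ι), Fintype.sum_prod_type]
  rfl

theorem ip_outer_right (A : (Fin (m + 2) → ι) → ℝ) (ξ : ι → ℝ) (ψ : (Fin (m + 1) → ι) → ℝ) :
    ip A (outer ξ ψ) = ∑ i, ξ i * ∑ K, A (Fin.cons i K) * ψ K := by
  simp only [ip, sum_cons (m := m + 1), outer_cons, Finset.mul_sum]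
  refine Finset.sum_congr rfl fun i _ => Finset.sum_congr rfl fun K _ => by ring

theorem ip_outer_self (ξ : ι → ℝ) (ψ : (Fin (m + 1) → ι) → ℝ) :
    ip (outer ξ ψ) (outer ξ ψ) = (∑ i, ξ i ^ 2) * ip ψ ψ := by
  rw [ip_outer_right, Finset.sum_mul]
  refine Finset.sum_congr rfl fun i _ => ?_
  simp only [outer_cons, ip, Finset.mul_sum]
  refine Finset.sum_congr rfl fun K _ => by ring

/-- Exchanging the first two indices pairs each `ξ` with a slot of the other `ψ`, which produces the
square of the contraction of `ξ` with `ψ`. -/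
theorem ip_outer_swap (ξ : ι → ℝ) (ψ : (Fin (m + 1) → ι) → ℝ) :
    ip (outer ξ ψ) (permute (swap 0 1) (outer ξ ψ)) = ip (tr (outer ξ ψ)) (tr (outer ξ ψ)) := by
  have h : ∀ (i j : ι) (w : Fin m → ι), outer ξ ψ (cons₂ i j w) = ξ i * ψ (Fin.cons j w) :=
    fun _ _ _ => rfl
  simp only [ip, sum_cons₂, permute, cons₂_comp_swap_zero_one, h, tr, Finset.sum_mul_sum]
  symm
  rw [Finset.sum_comm]
  refine Finset.sum_congr rfl fun i _ => ?_
  rw [Finset.sum_comm]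
  refine Finset.sum_congr rfl fun j _ => Finset.sum_congr rfl fun w _ => by ring

/-- Completely symmetric and trace-free arrays. -/
structure IsTFS (ψ : (Fin (m + 1) → ι) → ℝ) : Prop where
  symm : ∀ (σ : Perm (Fin (m + 1))) w, ψ (w ∘ σ) = ψ w
  tf : ∀ (w : Fin (m + 1) → ι) p q, p ≠ q → ∑ a, ψ (update (update w p a) q a) = 0

theorem IsTFS.outer {ψ : (Fin (m + 1) → ι) → ℝ} (hψ : IsTFS ψ) (ξ : ι → ℝ) :
    IsTFSTail (outer ξ ψ) where
  symm σ i w := by rw [outer_cons, outer_cons, hψ.symm]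
  tf i w p q h := by simp only [outer_cons, ← Finset.mul_sum, hψ.tf w p q h, mul_zero]

theorem IsTFS.eq_zero_of_subsingleton {ψ : (Fin (m + 1) → ι) → ℝ} (hψ : IsTFS ψ) (hm : m ≠ 0)
    [Subsingleton ι] : ψ = 0 := by
  funext w
  obtain ⟨m, rfl⟩ := Nat.exists_eq_succ_of_ne_zero hm
  have h := hψ.tf w 0 1 zero_ne_one
  rw [Fintype.sum_subsingleton _ (w 0)] at h
  exact (congrArg ψ (Subsingleton.elim _ _)).trans h

theorem IsTFS.card_pos {ψ : (Fin (m + 1) → ι) → ℝ} (h : ψ ≠ 0) :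
    1 ≤ Fintype.card ι := by
  refine Fintype.card_pos_iff.2 ?_
  by_contra hι
  rw [not_nonempty_iff] at hι
  exact h (funext fun w => (hι.false (w 0)).elim)

theorem IsTFS.two_le_card {ψ : (Fin (m + 1) → ι) → ℝ} (hψ : IsTFS ψ) (h : ψ ≠ 0) (hm : m ≠ 0) :
    2 ≤ Fintype.card ι := by
  by_contra hι
  have : Subsingleton ι := Fintype.card_le_one_iff_subsingleton.1 (by omega)
  exact h (hψ.eq_zero_of_subsingleton hm)

variable [DecidableEq ι]

/-- The norm of the contraction of a covector with a trace-free symmetric array. -/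
theorem IsTFS.ip_tr_outer_le {ψ : (Fin (m + 1) → ι) → ℝ} (hψ : IsTFS ψ) (h : ψ ≠ 0) (ξ : ι → ℝ) :
    (1 + m / ((Fintype.card ι : ℝ) + m - 2)) * ip (tr (KatoTensor.outer ξ ψ)) (tr (KatoTensor.outer ξ ψ))
      ≤ (∑ i, ξ i ^ 2) * ip ψ ψ := by
  have hn : m ≠ 0 → (Fintype.card ι : ℝ) + m - 2 ≠ 0 := by
    intro hm
    have h2 : (2 : ℝ) ≤ Fintype.card ι := by exact_mod_cast hψ.two_le_card h hm
    have h1 : (1 : ℝ) ≤ m := by exact_mod_cast Nat.one_le_iff_ne_zero.2 hm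
    exact ne_of_gt (by linarith)
  -- For `m = 0` the quotient `m / (n + m - 2)` is `0` even when its denominator vanishes, and the
  -- bound is the Cauchy–Schwarz inequality.
  have := ip_skewTF_self_nonneg (hψ.outer ξ) hn
  rw [ip_outer_swap, ip_outer_self] at this
  have e : 1 / ((Fintype.card ι : ℝ) + m - 2) * ((m : ℝ) / 2 *
      ip (tr (KatoTensor.outer ξ ψ)) (tr (KatoTensor.outer ξ ψ))) = 1 / 2 * (m / ((Fintype.card ι : ℝ) + m - 2) *
      ip (tr (KatoTensor.outer ξ ψ)) (tr (KatoTensor.outer ξ ψ))) := by ring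
  rw [e] at this
  linarith

/-- Here `A` is totally symmetric and trace-free, so it pairs with `ξ ⊗ ψ` only through `symTF (ξ ⊗
ψ)`. The norm of that part grows with the contraction term, which `ip_tr_outer_le` bounds. -/
theorem kato_of_skew_eq_zero {A : (Fin (m + 2) → ι) → ℝ} (hA : IsTFSTail A)
    {ψ : (Fin (m + 1) → ι) → ℝ} (hψ : IsTFS ψ) (h : ψ ≠ 0) (ξ : ι → ℝ)
    (hs : skew A = 0) (ht : tr A = 0) :
    ip A (outer ξ ψ) ^ 2 ≤ ((Fintype.card ι : ℝ) + m - 1) / ((Fintype.card ι : ℝ) + 2 * m)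
      * ip A A * ((∑ i, ξ i ^ 2) * ip ψ ψ) := by
  have hn1 : (1 : ℝ) ≤ Fintype.card ι := by exact_mod_cast IsTFS.card_pos h
  have hm0 : (0 : ℝ) ≤ m := Nat.cast_nonneg m
  have hnm : (Fintype.card ι : ℝ) + 2 * m ≠ 0 := ne_of_gt (by linarith)
  have hsymA : sym A = A := by
    conv_rhs => rw [eq_sym_add_sum_skew hA.symm, hs]
    have : ∀ q : Fin (m + 1), permute (swap 1 q.succ) (0 : (Fin (m + 2) → ι) → ℝ) = 0 :=
      fun _ => rfl
    simp [this]
  have hab : ip A (outer ξ ψ) = ip A (symTF (outer ξ ψ)) := by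
    rw [symTF, ip_sub_right, ip_smul_right, ← ip_sym_left, ← ip_sym_left, hsymA,
      ip_comm A (metricMul _), ip_metricMul, ht, ip_comm _ (0 : (Fin m → ι) → ℝ), ip_zero_left]
    ring
  -- In this case the constant is `0`, and indeed `tr A = 0` forces `A = 0`. Otherwise `n ≥ 2`.
  by_cases hcase : Fintype.card ι = 1 ∧ m = 0
  · obtain ⟨hc, rfl⟩ := hcase
    have : Subsingleton ι := Fintype.card_le_one_iff_subsingleton.1 hc.le
    have hA0 : A = 0 := by
      funext J
      have := congrFun ht (fun s : Fin 0 => J 0)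
      rw [tr, Fintype.sum_subsingleton _ (J 0)] at this
      exact (congrArg A (Subsingleton.elim _ _)).trans this
    simp [hA0, ip_zero_left]
  have hcs := ip_sq_le A (symTF (outer ξ ψ))
  rw [hab]
  refine hcs.trans ?_
  rw [mul_comm (_ / _) (ip A A), mul_assoc]
  refine mul_le_mul_of_nonneg_left ?_ (ip_self_nonneg A)
  rw [ip_symTF_self (hψ.outer ξ) hnm, ip_outer_self, ip_outer_swap]
  have hI := hψ.ip_tr_outer_le h ξ
  set P := (∑ i, ξ i ^ 2) * ip ψ ψ
  set I := ip (tr (outer ξ ψ)) (tr (outer ξ ψ))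
  have hn2 : (2 : ℝ) ≤ Fintype.card ι := by
    by_cases hm : m = 0
    · have : 2 ≤ Fintype.card ι := by
        have := IsTFS.card_pos h
        omega
      exact_mod_cast this
    · exact_mod_cast hψ.two_le_card h hm
  set n : ℝ := (Fintype.card ι : ℝ)
  -- The gap in the desired bound is a nonnegative multiple of the contraction bound with its
  -- denominator cleared.
  have hident : (n + m - 1) / (n + 2 * m) * P - (((m : ℝ) + 2)⁻¹ * (P + ((m : ℝ) + 1) * I)
      - ((m : ℝ) + 1) / (n + 2 * m) * (2 / ((m : ℝ) + 2) * I))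
      = (m + 1) / ((m + 2) * (n + 2 * m)) * ((n + m - 2) * P - (n + 2 * m - 2) * I) := by
    field_simp
    ring
  have hkey : 0 ≤ (n + m - 2) * P - (n + 2 * m - 2) * I := by
    -- If `n + m = 2` then `n = 2` and `m = 0`, and both coefficients vanish.
    rcases (show 0 ≤ n + m - 2 by linarith).eq_or_lt with h0 | h0
    · have hm' : (m : ℝ) = 0 := by linarith
      have hn' : n = 2 := by linarith
      rw [hm', hn']
      norm_num
    · have := mul_le_mul_of_nonneg_left hI h0.le
      have e : (n + m - 2) * ((1 + m / (n + m - 2)) * I) = (n + 2 * m - 2) * I := by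
        field_simp
        ring
      linarith
  have : 0 ≤ (m + 1) / ((m + 2) * (n + 2 * m)) * ((n + m - 2) * P - (n + 2 * m - 2) * I) :=
    mul_nonneg (div_nonneg (by linarith) (mul_nonneg (by linarith) (by linarith))) hkey
  linarith

/-- `sym` is an orthogonal projection and `A` lies in its kernel, so `ξ ⊗ ψ` may be replaced by its
component there, whose squared norm is `(m + 1) / (m + 2)` times `P - I`; then `I` is dropped. -/
theorem kato_of_sym_eq_zero {A : (Fin (m + 2) → ι) → ℝ}
    {ψ : (Fin (m + 1) → ι) → ℝ} (hψ : IsTFS ψ) (ξ : ι → ℝ) (hs : sym A = 0) :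
    ip A (outer ξ ψ) ^ 2 ≤ ((m : ℝ) + 1) / ((m : ℝ) + 2)
      * ip A A * ((∑ i, ξ i ^ 2) * ip ψ ψ) := by
  set B := outer ξ ψ with hBdef
  have hab : ip A B = ip A (B - sym B) := by
    rw [ip_sub_right, ← ip_sym_left, hs, ip_zero_left, sub_zero]
  have hbb : ip (B - sym B) (B - sym B) = ((m : ℝ) + 1) / ((m : ℝ) + 2) *
      ((∑ i, ξ i ^ 2) * ip ψ ψ - ip (tr B) (tr B)) := by
    have h1 : ip (sym B) (B - sym B) = 0 := by
      have : sym (sym B) = sym B := sym_of_forall_permute fun σ => permute_sym σ B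
      rw [ip_sub_right, ← ip_sym_left (sym B), this, sub_self]
    rw [ip_sub_left, h1, sub_zero, ip_sub_right, ip_comm B (sym B),
      ip_sym B (hψ.outer ξ) (hψ.outer ξ), hBdef, ip_outer_swap, ip_outer_self]
    field_simp
    ring
  have hcs := ip_sq_le A (B - sym B)
  rw [hab]
  refine hcs.trans ?_
  rw [hbb, mul_comm (_ / _) (ip A A), mul_assoc]
  refine mul_le_mul_of_nonneg_left (mul_le_mul_of_nonneg_left ?_ (by positivity)) (ip_self_nonneg A)
  linarith [ip_self_nonneg (tr B)]

/-- `A` is determined by its trace, so Cauchy–Schwarz is applied to the traces, and the contraction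
bound finishes. -/
theorem kato_of_symTF_skewTF_eq_zero {A : (Fin (m + 2) → ι) → ℝ} (hA : IsTFSTail A)
    {ψ : (Fin (m + 1) → ι) → ℝ} (hψ : IsTFS ψ) (h : ψ ≠ 0) (ξ : ι → ℝ)
    (hL : symTF A = 0) (hK : skewTF A = 0) :
    ip A (outer ξ ψ) ^ 2 ≤ ((m : ℝ) + 1) / ((Fintype.card ι : ℝ) + 2 * m)
      * ip A A * ((∑ i, ξ i ^ 2) * ip ψ ψ) := by
  have hI := hψ.ip_tr_outer_le h ξ
  have hn1 : (1 : ℝ) ≤ Fintype.card ι := by exact_mod_cast IsTFS.card_pos h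
  have hm0 : (0 : ℝ) ≤ m := Nat.cast_nonneg m
  set n : ℝ := (Fintype.card ι : ℝ) with hn
  set c : ℝ := m / (n + m - 2) with hc
  have hnc : c * (n + m - 2) = m := by
    by_cases hm : m = 0
    · simp [hc, hm]
    · have h2 : (2 : ℝ) ≤ Fintype.card ι := by exact_mod_cast hψ.two_le_card h hm
      have h1 : (1 : ℝ) ≤ m := by exact_mod_cast Nat.one_le_iff_ne_zero.2 hm
      rw [hc, div_mul_cancel₀]
      exact ne_of_gt (by linarith)
  have hnm : n + 2 * m ≠ 0 := ne_of_gt (by linarith)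
  set β : ℝ := (m + 1) / (n + 2 * m) * (1 + c) with hβ
  -- Pairing the two hypotheses with `B` gives two linear equations for `ip A B` and `ip A (permute
  -- (swap 0 1) B)`; `β` is what results from eliminating the second unknown. It is used for `B = A`
  -- and for `B = ξ ⊗ ψ`.
  have hip : ∀ B : (Fin (m + 2) → ι) → ℝ, IsTFSTail B → ip A B = β * ip (tr A) (tr B) := by
    intro B hB
    have h1 := ip_symTF hA hB
    have h2 := ip_skewTF (A := A) hB
    rw [hL, ip_zero_left] at h1
    rw [hK, ip_zero_left] at h2
    rw [← hn] at h1 h2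
    set d := ip (tr A) (tr B)
    set q := ip A (permute (swap 0 1) B)
    set b := ip A B
    have h2' : q = b - c * d := by
      have : 1 / (n + m - 2) * ((m : ℝ) / 2 * d) = 1 / 2 * (c * d) := by rw [hc]; ring
      rw [this] at h2
      linarith
    have h1' : b + (m + 1) * q = 2 * ((m + 1) / (n + 2 * m)) * d := by
      field_simp at h1 ⊢
      linarith
    rw [h2'] at h1'
    have h3 : (m + 2) * b = (2 * ((m + 1) / (n + 2 * m)) + (m + 1) * c) * d := by linarith
    have h4 : 2 * ((m + 1) / (n + 2 * m)) + (m + 1) * c = (m + 2) * β := by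
      have he : ((m : ℝ) + 1) / (n + 2 * m) * (n + 2 * m) = m + 1 := div_mul_cancel₀ _ hnm
      rw [hβ]
      linear_combination ((m : ℝ) + 1) / (n + 2 * m) * hnc - c * he
    rw [h4, mul_assoc] at h3
    exact mul_left_cancel₀ (by positivity) h3
  have haa := hip A hA
  rw [hip _ (hψ.outer ξ)]
  have hcs := ip_sq_le (tr A) (tr (outer ξ ψ))
  set P := (∑ i, ξ i ^ 2) * ip ψ ψ
  set I := ip (tr (outer ξ ψ)) (tr (outer ξ ψ))
  calc (β * ip (tr A) (tr (outer ξ ψ))) ^ 2 = β ^ 2 * ip (tr A) (tr (outer ξ ψ)) ^ 2 := by ring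
    _ ≤ β ^ 2 * (ip (tr A) (tr A) * I) := mul_le_mul_of_nonneg_left hcs (sq_nonneg _)
    _ = ip A A * ((m + 1) / (n + 2 * m) * ((1 + c) * I)) := by rw [haa, hβ]; ring
    _ ≤ ip A A * ((m + 1) / (n + 2 * m) * P) := by
        refine mul_le_mul_of_nonneg_left (mul_le_mul_of_nonneg_left hI ?_) (ip_self_nonneg A)
        exact div_nonneg (by linarith) (by linarith)
    _ = _ := by ring

/-- The passage from the bound on the pairing with `ξ ⊗ ψ` to a bound on the contraction. -/
theorem sum_sq_le_of_ip_outer_le {A : (Fin (m + 2) → ι) → ℝ} {ψ : (Fin (m + 1) → ι) → ℝ} {c : ℝ}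
    (hc : 0 ≤ c) (h : ∀ ξ : ι → ℝ, ip A (outer ξ ψ) ^ 2 ≤ c * ip A A * ((∑ i, ξ i ^ 2) * ip ψ ψ)) :
    ∑ i, (∑ K, A (Fin.cons i K) * ψ K) ^ 2 ≤ c * ip A A * ip ψ ψ := by
  -- With this `ξ` both the pairing and `|ξ|²` equal `S`, so the hypothesis reads `S² ≤ c |A|² S
  -- |ψ|²` and one factor `S` cancels.
  have h1 := h fun i => ∑ K, A (Fin.cons i K) * ψ K
  rw [ip_outer_right] at h1
  simp only [← sq] at h1
  set S := ∑ i, (∑ K, A (Fin.cons i K) * ψ K) ^ 2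
  rcases (show 0 ≤ S from Finset.sum_nonneg fun _ _ => sq_nonneg _).eq_or_lt with h0 | h0
  · rw [← h0]
    exact mul_nonneg (mul_nonneg hc (ip_self_nonneg _)) (ip_self_nonneg _)
  · refine le_of_mul_le_mul_right (a := S) ?_ h0
    linarith

end KatoArrays

/-! ### Contractions in a frame that is not orthonormal -/

section Gram

open Function

variable {V : Type*} [NormedAddCommGroup V] [InnerProductSpace ℝ V]
variable {ι κ : Type*} [Fintype ι] [DecidableEq ι] [Fintype κ]

/-- The inverse of the Gram matrix of a family of vectors. -/
def gramInv (E : ι → V) : Matrix ι ι ℝ := (Matrix.gram ℝ E)⁻¹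

/-- The inverse metric is the sum of the squares `e_j ⊗ e_j`, expressed here in the basis `E`. -/
theorem gramInv_eq (e : OrthonormalBasis κ ℝ V) (E : Module.Basis ι ℝ V) (a b : ι) :
    gramInv E a b = ∑ j, E.repr (e j) a * E.repr (e j) b := by
  have h : (Matrix.of fun a b => ∑ j, E.repr (e j) a * E.repr (e j) b) *
      Matrix.gram ℝ E = 1 := by
    ext a c
    have h1 : ∀ j, ∑ b, E.repr (e j) b * ⟪E b, E c⟫_ℝ = ⟪e j, E c⟫_ℝ := by
      intro j
      conv_rhs => rw [← E.sum_repr (e j), sum_inner]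
      simp only [real_inner_smul_left]
    have h2 : ∑ j, ⟪e j, E c⟫_ℝ * E.repr (e j) a = E.repr (E c) a := by
      conv_rhs => rw [← e.sum_repr' (E c)]
      simp
    simp only [Matrix.mul_apply, Matrix.of_apply, Matrix.gram_apply, Finset.sum_mul]
    rw [Finset.sum_comm]
    simp only [mul_assoc, ← Finset.mul_sum, h1]
    rw [Finset.sum_congr rfl fun j _ => mul_comm _ _, h2, E.repr_self, Finsupp.single_apply,
      Matrix.one_apply]
    simp only [eq_comm]
  rw [gramInv, Matrix.inv_eq_left_inv h, Matrix.of_apply]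

theorem sum_gramInv_mul (E : Module.Basis ι ℝ V) (a c : ι) :
    ∑ b, gramInv E a b * ⟪E b, E c⟫_ℝ = if a = c then 1 else 0 := by
  have h : IsUnit (Matrix.gram ℝ E).det :=
    (Matrix.det_gram_ne_zero_iff_linearIndependent.2 E.linearIndependent).isUnit
  have := congrFun (congrFun (Matrix.nonsing_inv_mul _ h) a) c
  rwa [Matrix.mul_apply, Matrix.one_apply] at this

/-- `stdOrthonormalBasis` is chosen separately at each point and cannot be differentiated. This and
the next lemma rewrite contractions in a frame that varies smoothly. -/
theorem sum_orthonormalBasis_eq (e : OrthonormalBasis κ ℝ V) (E : Module.Basis ι ℝ V)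
    (B : V →ₗ[ℝ] V →ₗ[ℝ] ℝ) :
    ∑ j, B (e j) (e j) = ∑ a, ∑ b, gramInv E a b * B (E a) (E b) := by
  have h : ∀ j, B (e j) (e j) = ∑ a, ∑ b, E.repr (e j) a * E.repr (e j) b * B (E a) (E b) := by
    intro j
    conv_lhs => rw [← E.sum_repr (e j)]
    simp only [map_sum, map_smul, LinearMap.sum_apply, LinearMap.smul_apply, smul_eq_mul,
      Finset.mul_sum]
    rw [Finset.sum_comm]
    refine Finset.sum_congr rfl fun a _ => Finset.sum_congr rfl fun b _ => by ring
  simp only [h, gramInv_eq e, Finset.sum_mul]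
  rw [Finset.sum_comm]
  refine Finset.sum_congr rfl fun a _ => Finset.sum_comm

theorem sum_sq_orthonormalBasis_eq {r : ℕ} (e : OrthonormalBasis κ ℝ V) (E : Module.Basis ι ℝ V)
    (T : MultilinearMap ℝ (fun _ : Fin r => V) ℝ) :
    ∑ J : Fin r → κ, T (fun s => e (J s)) ^ 2 = ∑ K : Fin r → ι, ∑ K' : Fin r → ι,
      (∏ s, gramInv E (K s) (K' s)) * (T (fun s => E (K s)) * T (fun s => E (K' s))) := by
  classical
  have h : ∀ J : Fin r → κ, T (fun s => e (J s))
      = ∑ K : Fin r → ι, (∏ s, E.repr (e (J s)) (K s)) * T (fun s => E (K s)) := by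
    intro J
    have h1 : (fun s => e (J s)) = fun s => ∑ b, E.repr (e (J s)) b • E b := by
      funext s
      rw [E.sum_repr]
    rw [h1, T.map_sum]
    simp only [T.map_smul_univ, smul_eq_mul]
  have h2 : ∀ K K' : Fin r → ι, ∏ s, gramInv E (K s) (K' s)
      = ∑ J : Fin r → κ, (∏ s, E.repr (e (J s)) (K s)) * ∏ s, E.repr (e (J s)) (K' s) := by
    intro K K'
    simp only [gramInv_eq e, Finset.prod_univ_sum, Fintype.piFinset_univ, Finset.prod_mul_distrib]
  simp only [h, h2, sq, Finset.sum_mul, Finset.mul_sum]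
  rw [Finset.sum_comm]
  refine Finset.sum_congr rfl fun K _ => ?_
  rw [Finset.sum_comm]
  refine Finset.sum_congr rfl fun K' _ => Finset.sum_congr rfl fun J _ => by ring

/-- This product is the cofactor left when the Leibniz rule differentiates the `s`-th inverse Gram
entry at a point where the frame is orthonormal. -/
theorem prod_erase_ite_eq {r : ℕ} (K K' : Fin r → ι) (s : Fin r) :
    (∏ t ∈ Finset.univ.erase s, if K t = K' t then (1 : ℝ) else 0)
      = ∑ b, if K' = update K s b then 1 else 0 := by
  rw [Finset.prod_ite_zero, Finset.prod_const_one]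
  by_cases h : ∀ t ∈ Finset.univ.erase s, K t = K' t
  · rw [if_pos h, Finset.sum_eq_single (K' s)]
    · rw [if_pos]
      funext t
      by_cases ht : t = s
      · subst ht; simp
      · simp [ht, h t (Finset.mem_erase.2 ⟨ht, Finset.mem_univ _⟩)]
    · intro b _ hb
      refine if_neg fun h' => hb ?_
      simp [h']
    · simp
  · rw [if_neg h, Finset.sum_eq_zero]
    intro b _
    refine if_neg fun h' => h ?_
    intro t ht
    rw [h', update_of_ne (Finset.ne_of_mem_erase ht)]

end Gram

/-! ### Directional derivatives of functions on a manifold -/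

section DirDeriv

variable {n : ℕ} {M : Type*} [TopologicalSpace M] [ChartedSpace (EuclideanSpace ℝ (Fin n)) M]

/-- `f` is differentiable at `x`, with derivative `c` in the direction `X`. -/
def HasDirDeriv (x : M) (X : TangentSpace (𝓡 n) x) (f : M → ℝ) (c : ℝ) : Prop :=
  MDifferentiableAt (𝓡 n) 𝓘(ℝ) f x ∧ mvfderiv (𝓡 n) f x X = c

variable {x : M} {X : TangentSpace (𝓡 n) x} {f g : M → ℝ} {c d : ℝ}

theorem _root_.MDifferentiableAt.hasDirDeriv (hf : MDifferentiableAt (𝓡 n) 𝓘(ℝ) f x)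
    (X : TangentSpace (𝓡 n) x) : HasDirDeriv x X f (mvfderiv (𝓡 n) f x X) := ⟨hf, rfl⟩

namespace HasDirDeriv

theorem unique (hf : HasDirDeriv x X f c) (hf' : HasDirDeriv x X f d) : c = d :=
  hf.2.symm.trans hf'.2

theorem const (a : ℝ) : HasDirDeriv x X (fun _ => a) 0 :=
  ⟨mdifferentiableAt_const, by rw [mvfderiv_const]; rfl⟩

theorem add (hf : HasDirDeriv x X f c) (hg : HasDirDeriv x X g d) :
    HasDirDeriv x X (fun y => f y + g y) (c + d) :=
  ⟨hf.1.add hg.1, by rw [mvfderiv_fun_add hf.1 hg.1, ← hf.2, ← hg.2]; rfl⟩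

theorem mul (hf : HasDirDeriv x X f c) (hg : HasDirDeriv x X g d) :
    HasDirDeriv x X (fun y => f y * g y) (c * g x + f x * d) := by
  refine ⟨hf.1.mul hg.1, ?_⟩
  rw [mvfderiv_fun_mul hf.1 hg.1, ← hf.2, ← hg.2]
  simp
  ring

theorem congr (hf : HasDirDeriv x X f c) (h : ∀ᶠ y in nhds x, g y = f y) : HasDirDeriv x X g c := by
  refine ⟨hf.1.congr_of_eventuallyEq h, ?_⟩
  rw [← hf.2]
  have h1 : mfderiv (𝓡 n) 𝓘(ℝ) g x = mfderiv (𝓡 n) 𝓘(ℝ) f x :=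
    Filter.EventuallyEq.mfderiv_eq h
  simp only [mvfderiv, h1]
  rfl

theorem sum {κ : Type*} {s : Finset κ} {f : κ → M → ℝ} {c : κ → ℝ}
    (h : ∀ k ∈ s, HasDirDeriv x X (f k) (c k)) :
    HasDirDeriv x X (fun y => ∑ k ∈ s, f k y) (∑ k ∈ s, c k) := by
  classical
  induction s using Finset.induction_on with
  | empty => simpa using const 0
  | insert a s ha ih =>
    simp only [Finset.sum_insert ha]
    exact (h a (Finset.mem_insert_self _ _)).add
      (ih fun k hk => h k (Finset.mem_insert_of_mem hk))

theorem prod {κ : Type*} [DecidableEq κ] {s : Finset κ} {f : κ → M → ℝ} {c : κ → ℝ}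
    (h : ∀ k ∈ s, HasDirDeriv x X (f k) (c k)) :
    HasDirDeriv x X (fun y => ∏ k ∈ s, f k y) (∑ k ∈ s, (∏ l ∈ s.erase k, f l x) * c k) := by
  induction s using Finset.induction_on with
  | empty => simpa using const 1
  | insert a s ha ih =>
    simp only [Finset.prod_insert ha]
    have := (h a (Finset.mem_insert_self _ _)).mul
      (ih fun k hk => h k (Finset.mem_insert_of_mem hk))
    convert this using 1
    rw [Finset.sum_insert ha, Finset.erase_insert ha, Finset.mul_sum, mul_comm]
    congr 1
    refine Finset.sum_congr rfl fun k hk => ?_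
    have hka : a ≠ k := fun h => ha (h ▸ hk)
    rw [Finset.erase_insert_of_ne hka, Finset.prod_insert
      (fun h' => ha (Finset.mem_of_mem_erase h')), mul_assoc]

theorem comp {g : ℝ → ℝ} {g' : ℝ} (hf : HasDirDeriv x X f c) (hg : HasDerivAt g g' (f x)) :
    MDifferentiableAt (𝓡 n) 𝓘(ℝ) (fun y => g (f y)) x :=
  DifferentiableAt.comp_mdifferentiableAt (g := g) hg.differentiableAt hf.1

end HasDirDeriv

theorem mdifferentiableAt_det {κ : Type*} [Fintype κ] [DecidableEq κ] {G : M → Matrix κ κ ℝ}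
    (hG : ∀ a b, MDifferentiableAt (𝓡 n) 𝓘(ℝ) (fun y => G y a b) x) :
    MDifferentiableAt (𝓡 n) 𝓘(ℝ) (fun y => (G y).det) x := by
  simp only [Matrix.det_apply']
  -- The direction is irrelevant; only the differentiability component is extracted.
  exact (HasDirDeriv.sum (X := 0) fun σ _ => (HasDirDeriv.const _).mul
    (HasDirDeriv.prod fun i _ => (hG _ _).hasDirDeriv 0)).1

theorem mdifferentiableAt_inv {κ : Type*} [Fintype κ] [DecidableEq κ] {G : M → Matrix κ κ ℝ}
    (hG : ∀ a b, MDifferentiableAt (𝓡 n) 𝓘(ℝ) (fun y => G y a b) x) (h : (G x).det ≠ 0) (a b : κ) :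
    MDifferentiableAt (𝓡 n) 𝓘(ℝ) (fun y => (G y)⁻¹ a b) x := by
  simp only [Matrix.inv_def, Ring.inverse_eq_inv', Matrix.smul_apply, smul_eq_mul,
    Matrix.adjugate_apply]
  have h1 := HasDirDeriv.comp ((mdifferentiableAt_det hG).hasDirDeriv 0) (hasDerivAt_inv h)
  have h2 : MDifferentiableAt (𝓡 n) 𝓘(ℝ)
      (fun y => ((G y).updateRow b (Pi.single a 1)).det) x := by
    refine mdifferentiableAt_det fun i j => ?_
    by_cases hi : i = b
    · subst hi
      simp only [Matrix.updateRow_self]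
      exact mdifferentiableAt_const
    · simp only [Matrix.updateRow_ne hi]
      exact hG _ _
  exact h1.mul h2

end DirDeriv

/-! ### The covariant derivative at a point -/

section CovDeriv

open Function Equiv

variable {n : ℕ} {M : Type*} [TopologicalSpace M] [ChartedSpace (EuclideanSpace ℝ (Fin n)) M]
  [IsManifold (𝓡 n) ∞ M] [RiemannianBundle (fun x : M => TangentSpace (𝓡 n) x)]

/-- The extension of a tangent vector used by `covDeriv`. -/
abbrev vecExt {x : M} (v : TangentSpace (𝓡 n) x) (y : M) : TangentSpace (𝓡 n) y :=
  FiberBundle.extend (EuclideanSpace ℝ (Fin n)) v y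

theorem mem_baseSet_self (x : M) :
    x ∈ (trivializationAt (EuclideanSpace ℝ (Fin n)) (TangentSpace (𝓡 n)) x).baseSet :=
  FiberBundle.mem_baseSet_trivializationAt' x

/-- The extension has constant coordinates in the trivialization at `x`, so near `x` it depends
linearly on `v`. This makes `covDeriv` multilinear without a separate tensoriality argument. -/
theorem vecExt_eq {x y : M} (v : TangentSpace (𝓡 n) x)
    (hy : y ∈ (trivializationAt (EuclideanSpace ℝ (Fin n)) (TangentSpace (𝓡 n)) x).baseSet) :
    vecExt v y = (trivializationAt (EuclideanSpace ℝ (Fin n)) (TangentSpace (𝓡 n)) x).symmₗ ℝ y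
      ((trivializationAt (EuclideanSpace ℝ (Fin n)) (TangentSpace (𝓡 n)) x).linearMapAt ℝ x v) := by
  rw [Trivialization.coe_linearMapAt_of_mem _ (mem_baseSet_self x),
    Trivialization.symmₗ_apply _ hy]
  rfl

theorem eventually_mem_baseSet (x : M) : ∀ᶠ y in nhds x,
    y ∈ (trivializationAt (EuclideanSpace ℝ (Fin n)) (TangentSpace (𝓡 n)) x).baseSet :=
  (trivializationAt (EuclideanSpace ℝ (Fin n)) (TangentSpace (𝓡 n)) x).open_baseSet.mem_nhds
    (mem_baseSet_self x)

theorem vecExt_add {x : M} (u v : TangentSpace (𝓡 n) x) :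
    ∀ᶠ y in nhds x, vecExt (u + v) y = vecExt u y + vecExt v y := by
  filter_upwards [eventually_mem_baseSet (n := n) x] with y hy
  rw [vecExt_eq _ hy, vecExt_eq _ hy, vecExt_eq _ hy, ← map_add, ← map_add]

theorem vecExt_smul {x : M} (c : ℝ) (v : TangentSpace (𝓡 n) x) :
    ∀ᶠ y in nhds x, vecExt (c • v) y = c • vecExt v y := by
  filter_upwards [eventually_mem_baseSet (n := n) x] with y hy
  rw [vecExt_eq _ hy, vecExt_eq _ hy, ← map_smul, ← map_smul]

theorem mdifferentiableAt_vecExt {x : M} (v : TangentSpace (𝓡 n) x) :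
    MDifferentiableAt (𝓡 n) ((𝓡 n).prod 𝓘(ℝ, EuclideanSpace ℝ (Fin n)))
      (fun y => TotalSpace.mk' (EuclideanSpace ℝ (Fin n)) y (vecExt v y)) x :=
  FiberBundle.mdifferentiableAt_extend (𝓡 n) (EuclideanSpace ℝ (Fin n)) v

/-- The extensions of a basis form a basis at nearby points. -/
theorem eventually_exists_basis_vecExt {ι : Type*} {x : M}
    (b : Module.Basis ι ℝ (TangentSpace (𝓡 n) x)) :
    ∀ᶠ y in nhds x, ∃ E : Module.Basis ι ℝ (TangentSpace (𝓡 n) y),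
      ∀ a, E a = vecExt (b a) y := by
  filter_upwards [eventually_mem_baseSet (n := n) x] with y hy
  refine ⟨b.map ((Trivialization.continuousLinearEquivAt ℝ _ x (mem_baseSet_self x)).toLinearEquiv.trans
    (Trivialization.continuousLinearEquivAt ℝ _ y hy).symm.toLinearEquiv), fun a => ?_⟩
  rw [vecExt_eq _ hy, Trivialization.coe_linearMapAt_of_mem _ (mem_baseSet_self x),
    Trivialization.symmₗ_apply _ hy]
  rfl

variable {r : ℕ} {φ : TensorField n M r}

theorem IsSmooth.mdifferentiableAt (hφ : IsSmooth φ) {x : M}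
    (w : Fin r → TangentSpace (𝓡 n) x) :
    MDifferentiableAt (𝓡 n) 𝓘(ℝ) (fun y => φ y (fun s => vecExt (w s) y)) x :=
  (hφ x (fun s => vecExt (w s)) fun s =>
    FiberBundle.contMDiffAt_extend (𝓡 n) (EuclideanSpace ℝ (Fin n)) (w s)).mdifferentiableAt
      (by simp)

variable (D : CovariantDerivative (𝓡 n) (EuclideanSpace ℝ (Fin n))
    (fun x : M => TangentSpace (𝓡 n) x))

/-- The linear map `v ↦ D_X V`, where `V` is the extension of `v`. -/
def covVecExt (x : M) (X : TangentSpace (𝓡 n) x) :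
    TangentSpace (𝓡 n) x →ₗ[ℝ] TangentSpace (𝓡 n) x where
  toFun v := D (vecExt v) x X
  map_add' u v := by
    have h := mdifferentiableAt_add_section (mdifferentiableAt_vecExt u) (mdifferentiableAt_vecExt v)
    rw [D.isCovariantDerivativeOn.congr_of_eventuallyEq (mdifferentiableAt_vecExt (u + v)) h
      Filter.univ_mem (vecExt_add u v), D.isCovariantDerivativeOn.add (mdifferentiableAt_vecExt u)
      (mdifferentiableAt_vecExt v)]
    rfl
  map_smul' c v := by
    have h := (mdifferentiableAt_const (c := c)).smul_section (mdifferentiableAt_vecExt v)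
    rw [D.isCovariantDerivativeOn.congr_of_eventuallyEq (mdifferentiableAt_vecExt (c • v)) h
      Filter.univ_mem (vecExt_smul c v)]
    exact congrArg (fun L => L X)
      (D.isCovariantDerivativeOn.smul_const c (mdifferentiableAt_vecExt v))

theorem update_vecExt {x : M} (w : Fin r → TangentSpace (𝓡 n) x) (i : Fin r)
    (a : TangentSpace (𝓡 n) x) (y : M) :
    (fun s => vecExt (update w i a s) y) = update (fun s => vecExt (w s) y) i (vecExt a y) := by
  funext s
  by_cases hs : s = i
  · subst hs; simp
  · simp [hs]

/-- The derivative of the values of a tensor field on extended vectors, as a multilinear map. -/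
def derivVecExt (hφ : IsSmooth φ) (x : M) (X : TangentSpace (𝓡 n) x) :
    MultilinearMap ℝ (fun _ : Fin r => TangentSpace (𝓡 n) x) ℝ :=
  MultilinearMap.mk' (fun w => mvfderiv (𝓡 n) (fun y => φ y (fun s => vecExt (w s) y)) x X)
    (fun w i a b => by
      refine (((hφ.mdifferentiableAt (update w i a)).hasDirDeriv X |>.add
        ((hφ.mdifferentiableAt (update w i b)).hasDirDeriv X)).congr ?_).2
      filter_upwards [vecExt_add a b] with y hy
      rw [update_vecExt, update_vecExt, update_vecExt, ← MultilinearMap.map_update_add, hy])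
    (fun w i c a => by
      have h := (HasDirDeriv.const (x := x) (X := X) c).mul
        ((hφ.mdifferentiableAt (update w i a)).hasDirDeriv X)
      rw [zero_mul, zero_add] at h
      refine (h.congr ?_).2
      filter_upwards [vecExt_smul c a] with y hy
      rw [update_vecExt, update_vecExt, ← smul_eq_mul, ← MultilinearMap.map_update_smul, hy])

/-- The covariant derivative in a fixed direction, as a multilinear map. -/
def covDerivDir (hφ : IsSmooth φ) (x : M) (X : TangentSpace (𝓡 n) x) :
    MultilinearMap ℝ (fun _ : Fin r => TangentSpace (𝓡 n) x) ℝ :=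
  derivVecExt hφ x X - ∑ s : Fin r, (φ x).compLinearMap
    (update (fun _ => LinearMap.id) s (covVecExt D x X))

theorem covDerivDir_apply (hφ : IsSmooth φ) (x : M) (X : TangentSpace (𝓡 n) x)
    (w : Fin r → TangentSpace (𝓡 n) x) :
    covDerivDir D hφ x X w = mvfderiv (𝓡 n) (fun y => φ y (fun s => vecExt (w s) y)) x X
      - ∑ s, φ x (update w s (covVecExt D x X (w s))) := by
  simp only [covDerivDir, _root_.sub_apply, _root_.sum_apply,
    MultilinearMap.compLinearMap_apply]
  congr 1
  refine Finset.sum_congr rfl fun s _ => congrArg _ ?_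
  funext t
  by_cases ht : t = s
  · subst ht; simp
  · simp [ht]

/-- The covariant derivative at a point, as a multilinear map. -/
def covDerivMap (hφ : IsSmooth φ) (x : M) :
    MultilinearMap ℝ (fun _ : Fin (r + 1) => TangentSpace (𝓡 n) x) ℝ :=
  LinearMap.uncurryLeft (M := fun _ : Fin (r + 1) => TangentSpace (𝓡 n) x)
    { toFun := covDerivDir D hφ x
      map_add' := fun X Y => by
        ext w
        simp only [_root_.add_apply, covDerivDir_apply]
        have h : ∀ s, φ x (update w s (covVecExt D x (X + Y) (w s)))
            = φ x (update w s (covVecExt D x X (w s)))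
              + φ x (update w s (covVecExt D x Y (w s))) := by
          intro s
          rw [← MultilinearMap.map_update_add]
          congr 2
          exact map_add (D (vecExt (w s)) x) X Y
        rw [Finset.sum_congr rfl fun s _ => h s, Finset.sum_add_distrib, map_add]
        ring
      map_smul' := fun c X => by
        ext w
        simp only [_root_.smul_apply, covDerivDir_apply, RingHom.id_apply, smul_eq_mul]
        have h : ∀ s, φ x (update w s (covVecExt D x (c • X) (w s)))
            = c * φ x (update w s (covVecExt D x X (w s))) := by
          intro s
          rw [← smul_eq_mul, ← MultilinearMap.map_update_smul]
          congr 2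
          exact map_smul (D (vecExt (w s)) x) c X
        rw [Finset.sum_congr rfl fun s _ => h s, ← Finset.mul_sum, map_smul, smul_eq_mul]
        ring }

theorem covDerivMap_apply (hφ : IsSmooth φ) (x : M)
    (v : Fin (r + 1) → TangentSpace (𝓡 n) x) : covDerivMap D hφ x v = covDeriv D φ x v := by
  rw [covDerivMap, LinearMap.uncurryLeft_apply]
  exact covDerivDir_apply D hφ x (v 0) (Fin.tail v)

theorem covDeriv_cons (hφ : IsSmooth φ) (x : M) (X : TangentSpace (𝓡 n) x)
    (w : Fin r → TangentSpace (𝓡 n) x) :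
    covDeriv D φ x (Fin.cons X w) = covDerivDir D hφ x X w := by
  rw [← covDerivMap_apply D hφ, covDerivMap, LinearMap.uncurryLeft_apply]
  rfl

theorem covDerivDir_comp_perm (hφ : IsSmooth φ) (hs : ∀ x, IsSymm (fun v => φ x v)) (x : M)
    (X : TangentSpace (𝓡 n) x) (σ : Perm (Fin r)) (w : Fin r → TangentSpace (𝓡 n) x) :
    covDerivDir D hφ x X (w ∘ σ) = covDerivDir D hφ x X w := by
  rw [covDerivDir_apply, covDerivDir_apply]
  congr 1
  · congr 2
    funext y
    exact hs y σ (fun s => vecExt (w s) y)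
  · rw [← Equiv.sum_comp σ (fun s => φ x (update w s (covVecExt D x X (w s))))]
    refine Finset.sum_congr rfl fun s _ => ?_
    refine Eq.trans ?_ (hs x σ (update w (σ s) (covVecExt D x X (w (σ s)))))
    congr 1
    funext t
    by_cases ht : t = s
    · subst ht; simp
    · simp [ht]

end CovDeriv

/-! ### Metric compatibility: derivatives of the inverse metric, of the norm and of traces -/

section MetricDerivatives

open Function Equiv

variable {n : ℕ} {M : Type*} [TopologicalSpace M] [ChartedSpace (EuclideanSpace ℝ (Fin n)) M]
  [IsManifold (𝓡 n) ∞ M] [RiemannianBundle (fun x : M => TangentSpace (𝓡 n) x)]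
  [IsContMDiffRiemannianBundle (𝓡 n) ∞ (EuclideanSpace ℝ (Fin n))
    (fun x : M => TangentSpace (𝓡 n) x)]
  {D : CovariantDerivative (𝓡 n) (EuclideanSpace ℝ (Fin n)) (fun x : M => TangentSpace (𝓡 n) x)}
  {ι : Type*} [Fintype ι] [DecidableEq ι]

theorem hasDirDeriv_inner (hD : D.IsMetricCompatible) {x : M} (X u v : TangentSpace (𝓡 n) x) :
    HasDirDeriv x X (fun y => ⟪vecExt u y, vecExt v y⟫_ℝ)
      (⟪covVecExt D x X u, v⟫_ℝ + ⟪u, covVecExt D x X v⟫_ℝ) := by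
  refine ⟨(mdifferentiableAt_vecExt u).inner_bundle (mdifferentiableAt_vecExt v), ?_⟩
  have h := hD.mvfderiv_inner_eq (vecExt X) (mdifferentiableAt_vecExt u)
    (mdifferentiableAt_vecExt v)
  simp only [FiberBundle.extend_apply_self] at h
  exact h

/-- The coefficients of `D_X` of the extensions of an orthonormal basis. -/
def connCoeff (D : CovariantDerivative (𝓡 n) (EuclideanSpace ℝ (Fin n))
    (fun x : M => TangentSpace (𝓡 n) x)) {x : M} (X : TangentSpace (𝓡 n) x)
    (e : OrthonormalBasis ι ℝ (TangentSpace (𝓡 n) x)) (a b : ι) : ℝ :=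
  ⟪covVecExt D x X (e a), e b⟫_ℝ

theorem covVecExt_eq_sum {x : M} (X : TangentSpace (𝓡 n) x)
    (e : OrthonormalBasis ι ℝ (TangentSpace (𝓡 n) x)) (a : ι) :
    covVecExt D x X (e a) = ∑ b, connCoeff D X e a b • e b := by
  conv_lhs => rw [← e.sum_repr' (covVecExt D x X (e a))]
  exact Finset.sum_congr rfl fun b _ => by rw [connCoeff, real_inner_comm]

theorem gramInv_orthonormalBasis {x : M} (e : OrthonormalBasis ι ℝ (TangentSpace (𝓡 n) x))
    (a b : ι) : gramInv (fun a => vecExt (e a) x) a b = if a = b then 1 else 0 := by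
  have h : (fun a => vecExt (e a) x) = e.toBasis := by
    funext a
    simp
  rw [h, gramInv_eq e e.toBasis]
  simp [OrthonormalBasis.coe_toBasis_repr_apply, e.repr_self, PiLp.single_apply, eq_comm]

theorem mdifferentiableAt_gramInv (hD : D.IsMetricCompatible) {x : M}
    (e : OrthonormalBasis ι ℝ (TangentSpace (𝓡 n) x)) (a b : ι) :
    MDifferentiableAt (𝓡 n) 𝓘(ℝ) (fun y => gramInv (fun a => vecExt (e a) y) a b) x := by
  refine mdifferentiableAt_inv (fun a b => ?_) ?_ a b
  · exact (hasDirDeriv_inner hD 0 (e a) (e b)).1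
  · have h : (fun a => vecExt (e a) x) = e := by
      funext a
      simp
    rw [h, Matrix.det_gram_ne_zero_iff_linearIndependent]
    exact e.orthonormal.linearIndependent

/-- Differentiate `g^{ac} g_{cb} = δ^a_b` at `x`, where both matrices are the identity: the
derivative of the inverse is minus that of the Gram matrix. -/
theorem hasDirDeriv_gramInv (hD : D.IsMetricCompatible) {x : M} (X : TangentSpace (𝓡 n) x)
    (e : OrthonormalBasis ι ℝ (TangentSpace (𝓡 n) x)) (a b : ι) :
    HasDirDeriv x X (fun y => gramInv (fun a => vecExt (e a) y) a b)
      (-(connCoeff D X e a b + connCoeff D X e b a)) := by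
  have h1 : ∀ b, HasDirDeriv x X (fun y => gramInv (fun a => vecExt (e a) y) a b) _ :=
    fun b => (mdifferentiableAt_gramInv hD e a b).hasDirDeriv X
  have h2 := HasDirDeriv.sum (s := Finset.univ) fun c _ =>
    (h1 c).mul (hasDirDeriv_inner hD X (e c) (e b))
  have h3 := (HasDirDeriv.const (x := x) (X := X) (if a = b then 1 else 0)).congr
    (g := fun y => ∑ c, gramInv (fun a => vecExt (e a) y) a c * ⟪vecExt (e c) y, vecExt (e b) y⟫_ℝ)
    (by
      filter_upwards [eventually_exists_basis_vecExt e.toBasis] with y ⟨E, hE⟩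
      have hE' : (fun a => vecExt (e a) y) = E := by
        funext a
        rw [hE, OrthonormalBasis.coe_toBasis]
      have := sum_gramInv_mul E a b
      rw [← hE'] at this
      exact this)
  have h4 := h2.unique h3
  refine ⟨(h1 b).1, ?_⟩
  simp only [gramInv_orthonormalBasis] at h4
  simp only [FiberBundle.extend_apply_self, Finset.sum_add_distrib,
    orthonormal_iff_ite.1 e.orthonormal, mul_ite, ite_mul, mul_one, mul_zero, zero_mul, one_mul,
    Finset.sum_ite_eq, Finset.sum_ite_eq', Finset.mem_univ, if_true] at h4
  rw [connCoeff, connCoeff, real_inner_comm (e a)]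
  linarith

/-- Exchanging the `s`-th entry of `K` with `b` is an involution on the pairs `(K, b)`. -/
theorem sum_update_comm {r : ℕ} (s : Fin r) (F : (Fin r → ι) → ι → ℝ) :
    ∑ K : Fin r → ι, ∑ b, F (update K s b) (K s) = ∑ K, ∑ b, F K b := by
  have hinv : Involutive fun p : (Fin r → ι) × ι => (update p.1 s p.2, p.1 s) := by
    intro p
    simp
  rw [← Fintype.sum_prod_type' F, ← Equiv.sum_comp hinv.toPerm, Fintype.sum_prod_type]
  rfl

theorem sum_update_eq {x : M} {r : ℕ} (T : MultilinearMap ℝ (fun _ : Fin r => TangentSpace (𝓡 n) x) ℝ)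
    (X : TangentSpace (𝓡 n) x) (e : OrthonormalBasis ι ℝ (TangentSpace (𝓡 n) x)) (a : ι)
    (w : Fin r → TangentSpace (𝓡 n) x) (s : Fin r) :
    T (update w s (covVecExt D x X (e a)))
      = ∑ b, connCoeff D X e a b * T (update w s (e b)) := by
  rw [covVecExt_eq_sum X e, MultilinearMap.map_update_sum]
  simp only [MultilinearMap.map_update_smul, smul_eq_mul]

variable {r : ℕ} {φ : TensorField n M r}

/-- The derivative of the squared norm of a tensor field. -/
theorem hasDirDeriv_normSq (hD : D.IsMetricCompatible) (hφ : IsSmooth φ) {x : M}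
    (X : TangentSpace (𝓡 n) x) (e : OrthonormalBasis ι ℝ (TangentSpace (𝓡 n) x)) :
    HasDirDeriv x X (fun y => normSq (fun v => φ y v))
      (2 * ∑ K : Fin r → ι, covDerivDir D hφ x X (fun s => e (K s)) * φ x (fun s => e (K s))) := by
  have hg : ∀ K : Fin r → ι, HasDirDeriv x X (fun y => φ y (fun s => vecExt (e (K s)) y))
      (mvfderiv (𝓡 n) (fun y => φ y (fun s => vecExt (e (K s)) y)) x X) :=
    fun K => (hφ.mdifferentiableAt fun s => e (K s)).hasDirDeriv X
  have h1 := HasDirDeriv.sum (s := Finset.univ) fun (K : Fin r → ι) _ =>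
    HasDirDeriv.sum (s := Finset.univ) fun (K' : Fin r → ι) _ =>
      (HasDirDeriv.prod (s := Finset.univ) fun s _ =>
        hasDirDeriv_gramInv hD X e (K s) (K' s)).mul ((hg K).mul (hg K'))
  -- Near `x` the squared norm is a contraction in the extended frame, which is orthonormal at `x`
  -- but perhaps not nearby; hence the inverse Gram factors.
  have h2 := h1.congr (g := fun y => normSq (fun v => φ y v)) (by
    filter_upwards [eventually_exists_basis_vecExt e.toBasis] with y ⟨E, hE⟩
    have hE' : (fun a => vecExt (e a) y) = E := by
      funext a
      rw [hE, OrthonormalBasis.coe_toBasis]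
    have := sum_sq_orthonormalBasis_eq (stdOrthonormalBasis ℝ (TangentSpace (𝓡 n) y)) E (φ y)
    rw [← hE'] at this
    exact this)
  convert h2 using 1
  simp only [gramInv_orthonormalBasis, prod_erase_ite_eq]
  simp only [FiberBundle.extend_apply_self]
  set g : (Fin r → ι) → ℝ := fun K => φ x (fun s => e (K s)) with hgdef
  set g' : (Fin r → ι) → ℝ := fun K => 
    mvfderiv (𝓡 n) (fun y => φ y (fun s => vecExt (e (K s)) y)) x X with hg'def
  have hprod : ∀ K K' : Fin r → ι, (∏ s, if K s = K' s then (1 : ℝ) else 0)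
      = if K = K' then 1 else 0 := by
    intro K K'
    rw [Finset.prod_ite_zero, Finset.prod_const_one]
    simp only [Finset.mem_univ, true_imp_iff, funext_iff]
  have hcov : ∀ K : Fin r → ι, covDerivDir D hφ x X (fun s => e (K s))
      = g' K - ∑ s, ∑ b, connCoeff D X e (K s) b * g (update K s b) := by
    intro K
    rw [covDerivDir_apply]
    congr 1
    refine Finset.sum_congr rfl fun s _ => ?_
    rw [sum_update_eq]
    refine Finset.sum_congr rfl fun b _ => ?_
    congr 2
    funext t
    by_cases ht : t = s
    · subst ht; simp
    · simp [ht]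
  have hA : ∀ K : Fin r → ι, ∑ K' : Fin r → ι, (∑ s, (∑ b, if K' = update K s b then (1 : ℝ) else 0)
      * -(connCoeff D X e (K s) (K' s) + connCoeff D X e (K' s) (K s))) * (g K * g K')
      = -(∑ s, ∑ b, connCoeff D X e (K s) b * (g K * g (update K s b)))
        - ∑ s, ∑ b, connCoeff D X e b (K s) * (g K * g (update K s b)) := by
    intro K
    simp only [Finset.sum_mul, ite_mul, one_mul, zero_mul]
    rw [Finset.sum_comm, ← Finset.sum_neg_distrib, ← Finset.sum_sub_distrib]
    refine Finset.sum_congr rfl fun s _ => ?_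
    rw [Finset.sum_comm, ← Finset.sum_neg_distrib, ← Finset.sum_sub_distrib]
    refine Finset.sum_congr rfl fun b _ => ?_
    rw [Finset.sum_ite_eq' Finset.univ (update K s b), if_pos (Finset.mem_univ _), update_self]
    ring
  have hB : ∀ K : Fin r → ι, ∑ K' : Fin r → ι, (∏ s, if K s = K' s then (1 : ℝ) else 0)
      * (g' K * g K' + g K * g' K') = 2 * (g' K * g K) := by
    intro K
    simp only [hprod, ite_mul, one_mul, zero_mul, Finset.sum_ite_eq, Finset.mem_univ, if_true]
    ring
  -- Differentiating an inverse Gram entry gives a connection coefficient and its transpose. After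
  -- relabelling they contribute equally, and together they are the connection terms of `2⟨D_X φ,
  -- φ⟩`.
  have hC : ∑ K : Fin r → ι, ∑ s, ∑ b, connCoeff D X e b (K s) * (g K * g (update K s b))
      = ∑ K : Fin r → ι, ∑ s, ∑ b, connCoeff D X e (K s) b * (g K * g (update K s b)) := by
    rw [Finset.sum_comm]
    conv_rhs => rw [Finset.sum_comm]
    refine Finset.sum_congr rfl fun s _ => ?_
    rw [← sum_update_comm s]
    refine Finset.sum_congr rfl fun K _ => Finset.sum_congr rfl fun b _ => ?_
    simp only [update_self, update_idem, update_eq_self]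
    ring
  have hE : ∀ K : Fin r → ι, covDerivDir D hφ x X (fun s => e (K s)) * g K
      = g' K * g K - ∑ s, ∑ b, connCoeff D X e (K s) b * (g K * g (update K s b)) := by
    intro K
    rw [hcov, sub_mul, Finset.sum_mul]
    congr 1
    refine Finset.sum_congr rfl fun s _ => ?_
    rw [Finset.sum_mul]
    refine Finset.sum_congr rfl fun b _ => by ring
  change 2 * ∑ K : Fin r → ι, covDerivDir D hφ x X (fun s => e (K s)) * g K
    = ∑ K : Fin r → ι, ∑ K' : Fin r → ι,
      ((∑ s, (∑ b, if K' = update K s b then (1 : ℝ) else 0)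
        * -(connCoeff D X e (K s) (K' s) + connCoeff D X e (K' s) (K s))) * (g K * g K')
      + (∏ s, if K s = K' s then (1 : ℝ) else 0) * (g' K * g K' + g K * g' K'))
  rw [Finset.sum_congr rfl fun K _ => hE K]
  simp only [Finset.sum_add_distrib, hA, hB, Finset.sum_sub_distrib, Finset.sum_neg_distrib, hC,
    ← Finset.mul_sum]
  ring

/-- A tensor with vanishing trace over the slots `i` and `j` in an orthonormal basis has vanishing
trace in every orthonormal basis. -/
theorem IsTraceFree.sum_orthonormalBasis {V : Type*} [NormedAddCommGroup V] [InnerProductSpace ℝ V]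
    [FiniteDimensional ℝ V] {T : MultilinearMap ℝ (fun _ : Fin r => V) ℝ}
    (hT : IsTraceFree fun v => T v) (E : Module.Basis ι ℝ V) {i j : Fin r} (hij : i ≠ j)
    (w : Fin r → V) : ∑ a, ∑ b, gramInv E a b * T (update (update w i (E a)) j (E b)) = 0 := by
  let B : V →ₗ[ℝ] V →ₗ[ℝ] ℝ := LinearMap.mk₂ ℝ (fun u v => T (update (update w i u) j v))
    (fun u u' v => by
      simp only [update_comm hij _ _ w, MultilinearMap.map_update_add])
    (fun c u v => by
      simp only [update_comm hij _ _ w, MultilinearMap.map_update_smul])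
    (fun u v v' => by simp only [MultilinearMap.map_update_add])
    (fun c u v => by simp only [MultilinearMap.map_update_smul])
  have := sum_orthonormalBasis_eq (stdOrthonormalBasis ℝ V) E B
  rw [show ∑ j, B (stdOrthonormalBasis ℝ V j) (stdOrthonormalBasis ℝ V j) = 0 from hT i j hij w]
    at this
  exact this.symm

/-- Differentiate `g^{ab} φ(…, E_a, …, E_b, …) = 0` in the extended frame. The derivative of
`g^{ab}` supplies the connection terms in the slots `i` and `j`. -/
theorem covDerivDir_traceFree (hD : D.IsMetricCompatible) (hφ : IsSmooth φ)
    (ht : ∀ x, IsTraceFree fun v => φ x v) {x : M} (X : TangentSpace (𝓡 n) x)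
    (e : OrthonormalBasis ι ℝ (TangentSpace (𝓡 n) x)) {i j : Fin r} (hij : i ≠ j)
    (w : Fin r → TangentSpace (𝓡 n) x) :
    ∑ a, covDerivDir D hφ x X (update (update w i (e a)) j (e a)) = 0 := by
  have htx : ∀ (w : Fin r → TangentSpace (𝓡 n) x) (i j : Fin r), i ≠ j →
      ∑ a, φ x (update (update w i (e a)) j (e a)) = 0 := by
    intro w i j hij
    have h := (ht x).sum_orthonormalBasis e.toBasis hij w
    have h2 : ∀ a b, gramInv e a b = if a = b then 1 else 0 := by
      intro a b
      rw [← gramInv_orthonormalBasis e]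
      simp only [FiberBundle.extend_apply_self]
    simpa [h2] using h
  set g : ι → ι → ℝ := fun a b => φ x (update (update w i (e a)) j (e b)) with hg
  have hf : ∀ a b, HasDirDeriv x X
      (fun y => φ y (fun s => vecExt (update (update w i (e a)) j (e b) s) y)) _ :=
    fun a b => (hφ.mdifferentiableAt _).hasDirDeriv X
  have h1 := HasDirDeriv.sum (s := Finset.univ) fun a _ =>
    HasDirDeriv.sum (s := Finset.univ) fun b _ => (hasDirDeriv_gramInv hD X e a b).mul (hf a b)
  have h2 := (HasDirDeriv.const (x := x) (X := X) 0).congr (g := fun y => ∑ a, ∑ b,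
      gramInv (fun a => vecExt (e a) y) a b *
        φ y (fun s => vecExt (update (update w i (e a)) j (e b) s) y)) (by
    filter_upwards [eventually_exists_basis_vecExt e.toBasis] with y ⟨E, hE⟩
    have hE' : (fun a => vecExt (e a) y) = E := by
      funext a
      rw [hE, OrthonormalBasis.coe_toBasis]
    have := (ht y).sum_orthonormalBasis E hij (fun s => vecExt (w s) y)
    simp only [update_vecExt]
    rw [← hE'] at this
    exact this)
  have h3 := h1.unique h2
  simp only [gramInv_orthonormalBasis] at h3
  simp only [FiberBundle.extend_apply_self, ite_mul, one_mul, zero_mul, Finset.sum_add_distrib,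
    Finset.sum_ite_eq, Finset.mem_univ, if_true] at h3
  -- A connection term in a slot other than `i` and `j` is itself a trace of `φ`, hence zero.
  have h4 : ∀ s, ∑ a, φ x (update (update (update w i (e a)) j (e a)) s
      (covVecExt D x X (update (update w i (e a)) j (e a) s)))
      = if s = i then ∑ a, ∑ b, connCoeff D X e b a * g a b
        else if s = j then ∑ a, ∑ b, connCoeff D X e a b * g a b else 0 := by
    intro s
    by_cases hsi : s = i
    · subst hsi
      rw [if_pos rfl]
      conv_rhs => rw [Finset.sum_comm]
      refine Finset.sum_congr rfl fun a _ => ?_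
      rw [update_of_ne hij, update_self, sum_update_eq]
      refine Finset.sum_congr rfl fun b _ => ?_
      rw [hg, update_comm hij.symm, update_idem]
    · rw [if_neg hsi]
      by_cases hsj : s = j
      · subst hsj
        rw [if_pos rfl]
        refine Finset.sum_congr rfl fun a _ => ?_
        rw [update_self, sum_update_eq]
        refine Finset.sum_congr rfl fun b _ => ?_
        rw [hg, update_idem]
      · rw [if_neg hsj]
        rw [← htx (update w s (covVecExt D x X (w s))) i j hij]
        refine Finset.sum_congr rfl fun a _ => ?_
        rw [update_of_ne hsj, update_of_ne hsi, update_comm (Ne.symm hsj), update_comm (Ne.symm hsi)]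
  simp only [covDerivDir_apply, Finset.sum_sub_distrib]
  rw [Finset.sum_comm (s := Finset.univ (α := ι)), Finset.sum_congr rfl fun s _ => h4 s]
  have h5 : ∀ (A B : ℝ), (∑ s, if s = i then A else if s = j then B else 0) = A + B := by
    intro A B
    have h : ∀ s, (if s = i then A else if s = j then B else 0)
        = (if s = i then A else 0) + if s = j then B else 0 := by
      intro s
      by_cases hsi : s = i
      · subst hsi; simp [hij]
      · simp [hsi]
    simp [h, Finset.sum_add_distrib]
  have h6 : ∑ a, ∑ b, -(connCoeff D X e a b + connCoeff D X e b a)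
      * φ x (update (update w i (e a)) j (e b))
      = -(∑ a, ∑ b, connCoeff D X e b a * g a b) - ∑ a, ∑ b, connCoeff D X e a b * g a b := by
    simp only [← Finset.sum_neg_distrib, ← Finset.sum_sub_distrib]
    refine Finset.sum_congr rfl fun a _ => Finset.sum_congr rfl fun b _ => ?_
    rw [hg]
    ring
  rw [h5]
  rw [h6] at h3
  linarith

end MetricDerivatives

/-! ### From tensors to components -/

section Components

open Function Equiv

variable {V : Type*} [NormedAddCommGroup V] [InnerProductSpace ℝ V] {r m : ℕ}
variable {ι : Type*} [Fintype ι] [DecidableEq ι]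

/-- The submodule of functions of `r` vectors that are multilinear. -/
def multilinear (V : Type*) [NormedAddCommGroup V] [InnerProductSpace ℝ V] (r : ℕ) :
    Submodule ℝ ((Fin r → V) → ℝ) where
  carrier := {f | ∃ g : MultilinearMap ℝ (fun _ : Fin r => V) ℝ, ⇑g = f}
  zero_mem' := ⟨0, rfl⟩
  add_mem' := by
    rintro _ _ ⟨g, rfl⟩ ⟨g', rfl⟩
    exact ⟨g + g', rfl⟩
  smul_mem' := by
    rintro c _ ⟨g, rfl⟩
    exact ⟨c • g, rfl⟩

theorem permute_mem_multilinear {f : (Fin r → V) → ℝ} (hf : f ∈ multilinear V r)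
    (σ : Perm (Fin r)) : permute σ f ∈ multilinear V r := by
  obtain ⟨g, rfl⟩ := hf
  exact ⟨g.domDomCongr σ, rfl⟩

theorem symmetrize_mem {P : Submodule ℝ ((Fin r → V) → ℝ)} (hP : ∀ f ∈ P, ∀ σ, permute σ f ∈ P)
    {f : (Fin r → V) → ℝ} (hf : f ∈ P) : symmetrize f ∈ P := by
  have h : symmetrize f = ((r.factorial : ℕ) : ℝ)⁻¹ • ∑ σ : Perm (Fin r), permute σ f := by
    funext J; simp [symmetrize, permute, Function.comp_def]
  rw [h]
  exact Submodule.smul_mem _ _ (Submodule.sum_mem _ fun σ _ => hP f hf σ)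

theorem skewFirst_mem {P : Submodule ℝ ((Fin (m + 2) → V) → ℝ)}
    (hP : ∀ f ∈ P, ∀ σ, permute σ f ∈ P) {f : (Fin (m + 2) → V) → ℝ} (hf : f ∈ P) :
    skewFirst f ∈ P :=
  Submodule.smul_mem _ (1 / 2 : ℝ) (sub_mem hf (hP f hf (swap 0 1)))

/-- The product of the metric with a tensor. -/
def innerMul (d : (Fin m → V) → ℝ) : (Fin (m + 2) → V) → ℝ :=
  fun v => ⟪v 0, v 1⟫_ℝ * d (fun a => v a.succ.succ)

theorem innerMul_mem_multilinear {d : (Fin m → V) → ℝ} (hd : d ∈ multilinear V m) :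
    innerMul d ∈ multilinear V (m + 2) := by
  obtain ⟨τ, rfl⟩ := hd
  let g (u : V) : MultilinearMap ℝ (fun _ : Fin (m + 1) => V) ℝ :=
    LinearMap.uncurryLeft (M := fun _ : Fin (m + 1) => V)
      ((LinearMap.toSpanSingleton ℝ _ τ).comp (innerₗ V u))
  have hg : ∀ u v, g u v = ⟪u, v 0⟫_ℝ * τ (fun a => v a.succ) := fun u v => rfl
  refine ⟨LinearMap.uncurryLeft (M := fun _ : Fin (m + 2) => V)
    { toFun := g
      map_add' := fun u u' => by
        ext v
        simp only [hg, _root_.add_apply, inner_add_left, add_mul]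
      map_smul' := fun c u => by
        ext v
        simp only [hg, _root_.smul_apply, real_inner_smul_left, RingHom.id_apply, smul_eq_mul,
          mul_assoc] }, ?_⟩
  rfl

/-- The skew-symmetrized product of the metric with a tensor. -/
def innerSkew (d : (Fin m → V) → ℝ) : (Fin (m + 2) → V) → ℝ :=
  ∑ s : Fin m, (1 / 2 : ℝ) • (permute (swap 0 1 * swap 0 s.succ.succ) (innerMul d)
    - permute (swap 0 s.succ.succ) (innerMul d))

theorem innerSkew_apply (d : (Fin m → V) → ℝ) (v : Fin (m + 2) → V) :
    innerSkew d v = ∑ s : Fin m, (1 / 2) *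
      (⟪v s.succ.succ, v 0⟫_ℝ * d (update (fun a => v a.succ.succ) s (v 1))
        - ⟪v s.succ.succ, v 1⟫_ℝ * d (update (fun a => v a.succ.succ) s (v 0))) := by
  conv_lhs => rw [← cons₂_eta v]
  simp only [innerSkew, Finset.sum_apply, Pi.smul_apply, Pi.sub_apply, smul_eq_mul, permute,
    Perm.coe_mul, ← Function.comp_assoc, cons₂_comp_swap_zero_one, cons₂_comp_swap_zero]
  rfl

theorem innerSkew_mem {P : Submodule ℝ ((Fin (m + 2) → V) → ℝ)}
    (hP : ∀ f ∈ P, ∀ σ, permute σ f ∈ P) {d : (Fin m → V) → ℝ} (hd : innerMul d ∈ P) :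
    innerSkew d ∈ P :=
  Submodule.sum_mem _ fun _ _ => Submodule.smul_mem _ _ (sub_mem (hP _ hd _) (hP _ hd _))

/-- The components of a tensor in an orthonormal basis. -/
def comps (e : OrthonormalBasis ι ℝ V) (f : (Fin r → V) → ℝ) : (Fin r → ι) → ℝ :=
  fun J => f (fun s => e (J s))

theorem eq_zero_iff_comps (e : OrthonormalBasis ι ℝ V) {f : (Fin r → V) → ℝ}
    (hf : f ∈ multilinear V r) : f = 0 ↔ comps e f = 0 := by
  refine ⟨fun h => by rw [h]; rfl, fun h => ?_⟩
  obtain ⟨g, rfl⟩ := hf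
  have : g = 0 := Module.Basis.ext_multilinear (fun _ => e.toBasis) fun J => by
    have hJ : g (fun s => e (J s)) = 0 := congrFun h J
    simpa using hJ
  rw [this]
  rfl

theorem comps_innerMul (e : OrthonormalBasis ι ℝ V) (d : (Fin m → V) → ℝ) :
    comps e (innerMul d) = metricMul (comps e d) := by
  funext J
  simp only [comps, innerMul, metricMul, orthonormal_iff_ite.1 e.orthonormal]

theorem comps_innerSkew (e : OrthonormalBasis ι ℝ V) (d : (Fin m → V) → ℝ) :
    comps e (innerSkew d) = metricSkew (comps e d) := by
  rw [metricSkew, ← comps_innerMul e d]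
  funext J
  simp only [comps, innerSkew, Finset.sum_apply, Pi.smul_apply, Pi.sub_apply]
  rfl

theorem comps_mem_pureTrace (e : OrthonormalBasis ι ℝ V) {f : (Fin (m + 2) → V) → ℝ}
    (hf : IsPureTrace f) : comps e f ∈ pureTrace ι m := by
  induction hf using Submodule.span_induction with
  | mem f hf =>
    obtain ⟨σ, τ, rfl⟩ := hf
    have h : comps e (fun v => ⟪v (σ 0), v (σ 1)⟫_ℝ * τ (fun a => v (σ a.succ.succ)))
        = permute σ (metricMul (comps e τ)) := by
      rw [← comps_innerMul]
      rfl
    rw [h]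
    exact permute_metricMul_mem _ _
  | zero => exact zero_mem _
  | add f g _ _ hf hg => exact add_mem hf hg
  | smul c f _ hf => exact Submodule.smul_mem _ c hf

theorem isPureTrace_of_trace_parts {f : (Fin (m + 2) → V) → ℝ}
    (hf : ∀ (σ : Perm (Fin (m + 1))) i w, f (Fin.cons i (w ∘ σ)) = f (Fin.cons i w))
    {d : (Fin m → V) → ℝ} (hd : d ∈ multilinear V m) {c c' : ℝ}
    (h1 : symmetrize f = c • symmetrize (innerMul d)) (h2 : skewFirst f = c' • innerSkew d) :
    IsPureTrace f := by
  set P : Submodule ℝ ((Fin (m + 2) → V) → ℝ) := Submodule.span ℝ {f : (Fin (m + 2) → V) → ℝ |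
    ∃ (σ : Equiv.Perm (Fin (m + 2))) (τ : MultilinearMap ℝ (fun _ : Fin m => V) ℝ),
      f = fun v => ⟪v (σ 0), v (σ 1)⟫_ℝ * τ (fun a => v (σ a.succ.succ))} with hPdef
  change f ∈ P
  have hP : ∀ f ∈ P, ∀ σ, permute σ f ∈ P := by
    intro f hf σ
    induction hf using Submodule.span_induction with
    | mem f hf =>
      obtain ⟨ρ, τ, rfl⟩ := hf
      exact Submodule.subset_span ⟨σ * ρ, τ, rfl⟩
    | zero => exact zero_mem _
    | add f g _ _ hf hg => exact add_mem hf hg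
    | smul c f _ hf => exact Submodule.smul_mem _ c hf
  have hdP : innerMul d ∈ P := by
    obtain ⟨τ, rfl⟩ := hd
    exact Submodule.subset_span ⟨1, τ, rfl⟩
  -- The array lemma is applied with the vectors themselves as indices, so no basis is needed.
  have h3 := eq_sym_add_sum_skew hf
  change f = symmetrize f + (2 / ((m : ℝ) + 2)) • ∑ q : Fin (m + 1),
    permute (swap 1 q.succ) (skewFirst f) at h3
  rw [h3, h1, h2]
  exact add_mem (Submodule.smul_mem _ _ (symmetrize_mem hP hdP)) (Submodule.smul_mem _ _
    (Submodule.sum_mem _ fun q _ => hP _ (Submodule.smul_mem _ _ (innerSkew_mem hP hdP)) _))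

theorem comp_cons_eq (e : OrthonormalBasis ι ℝ V) (i : ι) (w : Fin r → ι) :
    (fun s => e ((Fin.cons i w : Fin (r + 1) → ι) s))
      = (Fin.cons (e i) (fun s => e (w s)) : Fin (r + 1) → V) := by
  funext s
  exact Fin.cases rfl (fun _ => rfl) s

theorem comp_update_eq (e : OrthonormalBasis ι ℝ V) (w : Fin r → ι) (i : Fin r) (a : ι) :
    (fun s => e (update w i a s)) = update (fun s => e (w s)) i (e a) :=
  Function.comp_update e w i a

theorem isTFS_comps [FiniteDimensional ℝ V] {f : (Fin (m + 1) → V) → ℝ} (hs : IsSymm f)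
    (ht : IsTraceFree f) :
    IsTFS (comps (stdOrthonormalBasis ℝ V) f) where
  symm σ w := hs σ (fun s => stdOrthonormalBasis ℝ V (w s))
  tf w p q hpq := by
    simp only [comps, comp_update_eq]
    exact ht p q hpq _

theorem normSq_eq_ip [FiniteDimensional ℝ V] (f : (Fin r → V) → ℝ) :
    normSq f = ip (comps (stdOrthonormalBasis ℝ V) f) (comps (stdOrthonormalBasis ℝ V) f) := by
  simp only [normSq, ip, comps, sq]

end Components

/-! ### Vanishing denominators, and traces forced to vanish -/

section Degenerate

open Function Equiv

variable {ι : Type*} [Fintype ι] [DecidableEq ι] {m : ℕ} {A : (Fin (m + 2) → ι) → ℝ}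

theorem IsTFSTail.eq_zero_of_subsingleton (hA : IsTFSTail A) (hm : m ≠ 0) [Subsingleton ι] :
    A = 0 := by
  funext J
  obtain ⟨m, rfl⟩ := Nat.exists_eq_succ_of_ne_zero hm
  have h := hA.tf (J 0) (fun s => J s.succ) 0 1 zero_ne_one
  rw [Fintype.sum_subsingleton _ (J 0)] at h
  exact (congrArg A (Subsingleton.elim _ _)).trans h

theorem symTF_eq_zero_of_mem_pureTrace (hA : IsTFSTail A) (h : A ∈ pureTrace ι m) :
    symTF A = 0 := by
  by_cases hn : (Fintype.card ι : ℝ) + 2 * m = 0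
  · have hc : Fintype.card ι = 0 := by
      have : Fintype.card ι + 2 * m = 0 := by exact_mod_cast hn
      omega
    have : IsEmpty ι := Fintype.card_eq_zero_iff.1 hc
    funext J
    exact isEmptyElim (J 0)
  · exact symTF_eq_zero hA hn h

/-- If `n + m = 2` with `m ≥ 1`, then `n ≤ 1`, and an array trace-free in two tail slots is zero in
such dimensions. -/
theorem skewTF_eq_zero_of_mem_pureTrace (hA : IsTFSTail A) (h : A ∈ pureTrace ι m) :
    skewTF A = 0 := by
  by_cases hn : m ≠ 0 → (Fintype.card ι : ℝ) + m - 2 ≠ 0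
  · exact skewTF_eq_zero hA hn h
  · push Not at hn
    obtain ⟨hm, hc⟩ := hn
    have hc' : Fintype.card ι + m = 2 := by
      have : (Fintype.card ι : ℝ) + m = 2 := by linarith
      exact_mod_cast this
    have : Subsingleton ι := Fintype.card_le_one_iff_subsingleton.1 (by omega)
    have h0 : A = 0 := hA.eq_zero_of_subsingleton hm
    funext J
    simp [h0, skewTF, skew, metricSkew, metricMul, tr, permute]

/-- `A` is then totally symmetric, so the trace over the first two slots equals one over two tail
slots; these exist because `m ≠ 0`. -/
theorem tr_eq_zero_of_skew_eq_zero (hA : IsTFSTail A) (hm : m ≠ 0) (h : skew A = 0) :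
    tr A = 0 := by
  obtain ⟨m, rfl⟩ := Nat.exists_eq_succ_of_ne_zero hm
  funext w
  have hs : ∀ i j w, A (cons₂ i j w) = A (cons₂ j i w) := by
    intro i j w
    have := congrFun h (cons₂ i j w)
    rw [skew, cons₂_comp_swap_zero_one, Pi.zero_apply] at this
    linarith
  rw [Pi.zero_apply, ← hA.tr_one (w 0) w 0]
  refine Finset.sum_congr rfl fun a _ => ?_
  rw [← hA.exchange a a w 0, hs]

theorem tr_eq_zero_of_sym_eq_zero (hA : IsTFSTail A) (h : sym A = 0) : tr A = 0 := by
  have h1 := hA.tr_sym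
  rw [h] at h1
  have h2 : tr (0 : (Fin (m + 2) → ι) → ℝ) = 0 := by
    funext w
    simp [tr]
  rw [h2] at h1
  have : (2 / ((m : ℝ) + 2)) ≠ 0 := by positivity
  exact (smul_eq_zero.1 h1.symm).resolve_left this

end Degenerate

/-! ### Passage from tensor fields to component arrays, and the differential of the norm -/

section Fields

open Function Equiv

variable {n : ℕ} {M : Type*} [TopologicalSpace M] [ChartedSpace (EuclideanSpace ℝ (Fin n)) M]
  [IsManifold (𝓡 n) ∞ M] [RiemannianBundle (fun x : M => TangentSpace (𝓡 n) x)]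
  [IsContMDiffRiemannianBundle (𝓡 n) ∞ (EuclideanSpace ℝ (Fin n))
    (fun x : M => TangentSpace (𝓡 n) x)]
  {D : CovariantDerivative (𝓡 n) (EuclideanSpace ℝ (Fin n)) (fun x : M => TangentSpace (𝓡 n) x)}
  {m : ℕ} {φ : TensorField n M (m + 1)}

theorem finrank_tangentSpace (x : M) : Module.finrank ℝ (TangentSpace (𝓡 n) x) = n :=
  finrank_euclideanSpace_fin (𝕜 := ℝ) (n := n)

theorem card_tangentSpace (x : M) :
    (Fintype.card (Fin (Module.finrank ℝ (TangentSpace (𝓡 n) x))) : ℝ) = n := by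
  rw [Fintype.card_fin, finrank_tangentSpace]

/-- The components of the covariant derivative in the standard orthonormal basis. -/
def covComps (D : CovariantDerivative (𝓡 n) (EuclideanSpace ℝ (Fin n))
    (fun x : M => TangentSpace (𝓡 n) x)) (φ : TensorField n M (m + 1)) (x : M) :
    (Fin (m + 2) → Fin (Module.finrank ℝ (TangentSpace (𝓡 n) x))) → ℝ :=
  comps (stdOrthonormalBasis ℝ (TangentSpace (𝓡 n) x)) (covDeriv D φ x)

theorem covDeriv_mem_multilinear (hφ : IsSmooth φ) (x : M) :
    covDeriv D φ x ∈ multilinear (TangentSpace (𝓡 n) x) (m + 2) :=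
  ⟨covDerivMap D hφ x, funext fun v => covDerivMap_apply D hφ x v⟩

theorem divergence_mem_multilinear (hφ : IsSmooth φ) (x : M) :
    divergence D φ x ∈ multilinear (TangentSpace (𝓡 n) x) m := by
  have h : divergence D φ x = ∑ a, fun w => covDeriv D φ x
    (Fin.cons (stdOrthonormalBasis ℝ (TangentSpace (𝓡 n) x) a)
      (Fin.cons (stdOrthonormalBasis ℝ (TangentSpace (𝓡 n) x) a) w)) := by
    funext w
    simp only [divergence, Finset.sum_apply]
  rw [h]
  refine Submodule.sum_mem _ fun a _ => ?_
  refine ⟨((covDerivMap D hφ x).curryLeft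
    (stdOrthonormalBasis ℝ (TangentSpace (𝓡 n) x) a)).curryLeft
    (stdOrthonormalBasis ℝ (TangentSpace (𝓡 n) x) a), ?_⟩
  funext w
  exact covDerivMap_apply D hφ x _

theorem comps_divergence (x : M) :
    comps (stdOrthonormalBasis ℝ (TangentSpace (𝓡 n) x)) (divergence D φ x)
      = tr (covComps D φ x) := by
  funext w
  simp only [comps, divergence, tr, covComps, cons₂, comp_cons_eq]

theorem conformalKilling_eq (x : M) : conformalKilling D φ x = symmetrize (covDeriv D φ x)
    - (((m : ℝ) + 1) / ((n : ℝ) + 2 * m)) • symmetrize (innerMul (divergence D φ x)) := rfl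

theorem conformalCodazzi_eq (x : M) : conformalCodazzi D φ x = skewFirst (covDeriv D φ x)
    - (1 / ((n : ℝ) + m - 2)) • innerSkew (divergence D φ x) := by
  funext v
  rw [Pi.sub_apply, Pi.smul_apply, innerSkew_apply]
  rfl

theorem comps_conformalKilling (x : M) :
    comps (stdOrthonormalBasis ℝ (TangentSpace (𝓡 n) x)) (conformalKilling D φ x)
      = symTF (covComps D φ x) := by
  rw [symTF, ← comps_divergence, ← comps_innerMul, card_tangentSpace x, conformalKilling_eq]
  rfl

theorem comps_conformalCodazzi (x : M) :
    comps (stdOrthonormalBasis ℝ (TangentSpace (𝓡 n) x)) (conformalCodazzi D φ x)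
      = skewTF (covComps D φ x) := by
  rw [skewTF, ← comps_divergence, ← comps_innerSkew, card_tangentSpace x, conformalCodazzi_eq]
  rfl

theorem covComps_cons (hφ : IsSmooth φ) (x : M)
    (i : Fin (Module.finrank ℝ (TangentSpace (𝓡 n) x)))
    (w : Fin (m + 1) → Fin (Module.finrank ℝ (TangentSpace (𝓡 n) x))) :
    covComps D φ x (Fin.cons i w)
      = covDerivDir D hφ x (stdOrthonormalBasis ℝ (TangentSpace (𝓡 n) x) i)
        (fun s => stdOrthonormalBasis ℝ (TangentSpace (𝓡 n) x) (w s)) := by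
  rw [covComps, comps, comp_cons_eq, covDeriv_cons D hφ]

theorem isTFSTail_covComps (hD : D.IsMetricCompatible) (hφ : IsTraceFreeSymmField φ) (x : M) :
    IsTFSTail (covComps D φ x) where
  symm σ i w := by
    rw [covComps_cons hφ.smooth, covComps_cons hφ.smooth]
    exact covDerivDir_comp_perm D hφ.smooth hφ.symm x
      (stdOrthonormalBasis ℝ (TangentSpace (𝓡 n) x) i) σ
      (fun s => stdOrthonormalBasis ℝ (TangentSpace (𝓡 n) x) (w s))
  tf i w p q hpq := by
    simp only [covComps_cons hφ.smooth, comp_update_eq]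
    exact covDerivDir_traceFree hD hφ.smooth hφ.traceFree
      (stdOrthonormalBasis ℝ (TangentSpace (𝓡 n) x) i)
      (stdOrthonormalBasis ℝ (TangentSpace (𝓡 n) x)) hpq
      (fun s => stdOrthonormalBasis ℝ (TangentSpace (𝓡 n) x) (w s))

theorem conformalKilling_eq_zero_iff (hφ : IsSmooth φ) (x : M) :
    conformalKilling D φ x = 0 ↔ symTF (covComps D φ x) = 0 := by
  rw [← comps_conformalKilling]
  refine eq_zero_iff_comps _ ?_
  rw [conformalKilling_eq]
  exact sub_mem (symmetrize_mem (fun _ hf σ => permute_mem_multilinear hf σ)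
    (covDeriv_mem_multilinear hφ x)) (Submodule.smul_mem _ _ (symmetrize_mem
      (fun _ hf σ => permute_mem_multilinear hf σ)
      (innerMul_mem_multilinear (divergence_mem_multilinear hφ x))))

theorem conformalCodazzi_eq_zero_iff (hφ : IsSmooth φ) (x : M) :
    conformalCodazzi D φ x = 0 ↔ skewTF (covComps D φ x) = 0 := by
  rw [← comps_conformalCodazzi]
  refine eq_zero_iff_comps _ ?_
  rw [conformalCodazzi_eq]
  exact sub_mem (skewFirst_mem (fun _ hf σ => permute_mem_multilinear hf σ)
    (covDeriv_mem_multilinear hφ x)) (Submodule.smul_mem _ _ (innerSkew_mem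
      (fun _ hf σ => permute_mem_multilinear hf σ)
      (innerMul_mem_multilinear (divergence_mem_multilinear hφ x))))

theorem divergence_eq_zero_iff (hφ : IsSmooth φ) (x : M) :
    divergence D φ x = 0 ↔ tr (covComps D φ x) = 0 := by
  rw [← comps_divergence]
  exact eq_zero_iff_comps _ (divergence_mem_multilinear hφ x)

theorem skewFirst_eq_zero_iff (hφ : IsSmooth φ) (x : M) :
    skewFirst (covDeriv D φ x) = 0 ↔ skew (covComps D φ x) = 0 :=
  eq_zero_iff_comps (stdOrthonormalBasis ℝ (TangentSpace (𝓡 n) x))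
    (skewFirst_mem (fun _ hf σ => permute_mem_multilinear hf σ) (covDeriv_mem_multilinear hφ x))

theorem symmetrize_eq_zero_iff (hφ : IsSmooth φ) (x : M) :
    symmetrize (covDeriv D φ x) = 0 ↔ sym (covComps D φ x) = 0 :=
  eq_zero_iff_comps (stdOrthonormalBasis ℝ (TangentSpace (𝓡 n) x))
    (symmetrize_mem (fun _ hf σ => permute_mem_multilinear hf σ) (covDeriv_mem_multilinear hφ x))

theorem isPureTrace_covDeriv_iff (hD : D.IsMetricCompatible) (hφ : IsTraceFreeSymmField φ)
    (x : M) : IsPureTrace (covDeriv D φ x) ↔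
      conformalKilling D φ x = 0 ∧ conformalCodazzi D φ x = 0 := by
  constructor
  · intro h
    rw [conformalKilling_eq_zero_iff hφ.smooth, conformalCodazzi_eq_zero_iff hφ.smooth]
    have hA := isTFSTail_covComps hD hφ x
    have hp := comps_mem_pureTrace (stdOrthonormalBasis ℝ (TangentSpace (𝓡 n) x)) h
    exact ⟨symTF_eq_zero_of_mem_pureTrace hA hp, skewTF_eq_zero_of_mem_pureTrace hA hp⟩
  · rintro ⟨h1, h2⟩
    rw [conformalKilling_eq, sub_eq_zero] at h1
    rw [conformalCodazzi_eq, sub_eq_zero] at h2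
    refine isPureTrace_of_trace_parts (fun σ i w => ?_) (divergence_mem_multilinear hφ.smooth x)
      h1 h2
    rw [covDeriv_cons D hφ.smooth, covDeriv_cons D hφ.smooth]
    exact covDerivDir_comp_perm D hφ.smooth hφ.symm x _ σ _

/-- The differential of the norm, and the reduction of the refined Kato inequality to an algebraic
bound. -/
theorem fieldNorm_kato (hD : D.IsMetricCompatible) (hφ : IsTraceFreeSymmField φ) {x : M}
    (hx : fieldNorm φ x ≠ 0) {c : ℝ} (hc : 1 ≤ (n : ℝ) → 0 ≤ c)
    (h : ∀ (ψ : (Fin (m + 1) → Fin (Module.finrank ℝ (TangentSpace (𝓡 n) x))) → ℝ),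
      IsTFS ψ → ψ ≠ 0 → ∀ ξ, ip (covComps D φ x) (outer ξ ψ) ^ 2
        ≤ c * ip (covComps D φ x) (covComps D φ x) * ((∑ i, ξ i ^ 2) * ip ψ ψ)) :
    MDifferentiableAt (𝓡 n) 𝓘(ℝ) (fieldNorm φ) x ∧
      diffNormSq n (fieldNorm φ) x ≤ c * normSq (covDeriv D φ x) := by
  set e := stdOrthonormalBasis ℝ (TangentSpace (𝓡 n) x) with he
  set ψ := comps e (fun v => φ x v) with hψ
  have hN : normSq (fun v => φ x v) = ip ψ ψ := normSq_eq_ip _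
  have hN0 : 0 ≤ ip ψ ψ := ip_self_nonneg ψ
  have hsq : fieldNorm φ x * fieldNorm φ x = ip ψ ψ := by
    rw [fieldNorm, hN, Real.mul_self_sqrt hN0]
  have hpos : 0 < ip ψ ψ := by
    rw [← hsq]
    exact mul_self_pos.2 hx
  have hψ0 : ψ ≠ 0 := by
    intro h0
    rw [h0, ip_zero_left] at hpos
    exact lt_irrefl _ hpos
  -- A nonzero tensor of positive rank forces `n ≥ 1`, which is why `hc` asks for the sign of `c`
  -- only in that range.
  have hn : 1 ≤ (n : ℝ) := by
    rw [← card_tangentSpace x]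
    exact_mod_cast IsTFS.card_pos hψ0
  have hd := fun X => hasDirDeriv_normSq hD hφ.smooth X e
  have hdiff : MDifferentiableAt (𝓡 n) 𝓘(ℝ) (fieldNorm φ) x :=
    (hd 0).comp (Real.hasDerivAt_sqrt (by rw [hN]; exact hpos.ne'))
  refine ⟨hdiff, ?_⟩
  -- Both sides are half the derivative of `|φ|²`: one by the product rule for `|φ| · |φ|`, the
  -- other by `hasDirDeriv_normSq`.
  have hder : ∀ a, fieldNorm φ x * mvfderiv (𝓡 n) (fieldNorm φ) x (e a)
      = ∑ K, covComps D φ x (Fin.cons a K) * ψ K := by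
    intro a
    have h1 := ((hdiff.hasDirDeriv (e a)).mul (hdiff.hasDirDeriv (e a))).congr
      (g := fun y => normSq (fun v => φ y v)) (Filter.Eventually.of_forall fun y => by
        rw [fieldNorm, Real.mul_self_sqrt (by rw [normSq_eq_ip]; exact ip_self_nonneg _)])
    have h2 := h1.unique (hd (e a))
    simp only [covComps_cons hφ.smooth, hψ, comps]
    linarith
  have hkey := sum_sq_le_of_ip_outer_le (hc hn) (h ψ (isTFS_comps (hφ.symm x) (hφ.traceFree x)) hψ0)
  simp only [← hder, mul_pow, ← Finset.mul_sum] at hkey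
  rw [sq, hsq] at hkey
  have hdn : diffNormSq n (fieldNorm φ) x = ∑ a, mvfderiv (𝓡 n) (fieldNorm φ) x (e a) ^ 2 := by
    rw [diffNormSq, normSq]
    exact Equiv.sum_comp (Equiv.funUnique (Fin 1) _)
      (fun a => mvfderiv (𝓡 n) (fieldNorm φ) x (e a) ^ 2)
  rw [hdn, normSq_eq_ip]
  refine le_of_mul_le_mul_left ?_ hpos
  rw [mul_comm (ip ψ ψ) (c * _)]
  exact hkey

end Fields

/-! ### The three cases at a point -/

section Cases

variable {n : ℕ} {M : Type*} [TopologicalSpace M] [ChartedSpace (EuclideanSpace ℝ (Fin n)) M]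
  [IsManifold (𝓡 n) ∞ M] [RiemannianBundle (fun x : M => TangentSpace (𝓡 n) x)]
  [IsContMDiffRiemannianBundle (𝓡 n) ∞ (EuclideanSpace ℝ (Fin n))
    (fun x : M => TangentSpace (𝓡 n) x)]
  {D : CovariantDerivative (𝓡 n) (EuclideanSpace ℝ (Fin n)) (fun x : M => TangentSpace (𝓡 n) x)}
  {m : ℕ} {φ : TensorField n M (m + 1)} {x : M}

theorem metricMul_zero {ι : Type*} [DecidableEq ι] :
    metricMul (0 : (Fin m → ι) → ℝ) = 0 := by
  funext J
  simp [metricMul]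

theorem sym_zero {ι : Type*} {r : ℕ} : sym (0 : (Fin r → ι) → ℝ) = 0 := by
  funext J
  simp [sym]

theorem metricSkew_zero {ι : Type*} [DecidableEq ι] :
    metricSkew (0 : (Fin m → ι) → ℝ) = 0 := by
  funext J
  simp [metricSkew, metricMul_zero, permute]

theorem symTF_of_tr_eq_zero {ι : Type*} [Fintype ι] [DecidableEq ι] {A : (Fin (m + 2) → ι) → ℝ}
    (h : tr A = 0) : symTF A = sym A := by
  rw [symTF, h, metricMul_zero, sym_zero, smul_zero, sub_zero]

theorem skewTF_of_tr_eq_zero {ι : Type*} [Fintype ι] [DecidableEq ι] {A : (Fin (m + 2) → ι) → ℝ}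
    (h : tr A = 0) : skewTF A = skew A := by
  rw [skewTF, h, metricSkew_zero, smul_zero, sub_zero]

theorem conformalCodazzi_eq_zero_and_divergence_eq_zero_iff (hD : D.IsMetricCompatible)
    (hφ : IsTraceFreeSymmField φ) :
    (conformalCodazzi D φ x = 0 ∧ divergence D φ x = 0) ↔
      (skewFirst (covDeriv D φ x) = 0 ∧ (m + 1 = 1 → divergence D φ x = 0)) := by
  rw [conformalCodazzi_eq_zero_iff hφ.smooth, divergence_eq_zero_iff hφ.smooth,
    skewFirst_eq_zero_iff hφ.smooth]
  have hA := isTFSTail_covComps hD hφ x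
  constructor
  · rintro ⟨h1, h2⟩
    exact ⟨by rw [← skewTF_of_tr_eq_zero h2, h1], fun _ => h2⟩
  · rintro ⟨h1, h2⟩
    -- For `k = 1` there is only one tail slot, so the vanishing of the divergence has to be
    -- assumed.
    have h3 : tr (covComps D φ x) = 0 := by
      by_cases hm : m = 0
      · exact h2 (by omega)
      · exact tr_eq_zero_of_skew_eq_zero hA hm h1
    exact ⟨by rw [skewTF_of_tr_eq_zero h3, h1], h3⟩

theorem conformalKilling_eq_zero_and_divergence_eq_zero_iff (hD : D.IsMetricCompatible)
    (hφ : IsTraceFreeSymmField φ) :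
    (conformalKilling D φ x = 0 ∧ divergence D φ x = 0) ↔ symmetrize (covDeriv D φ x) = 0 := by
  rw [conformalKilling_eq_zero_iff hφ.smooth, divergence_eq_zero_iff hφ.smooth,
    symmetrize_eq_zero_iff hφ.smooth]
  constructor
  · rintro ⟨h1, h2⟩
    rw [← symTF_of_tr_eq_zero h2, h1]
  · intro h
    have h3 := tr_eq_zero_of_sym_eq_zero (isTFSTail_covComps hD hφ x) h
    exact ⟨by rw [symTF_of_tr_eq_zero h3, h], h3⟩

theorem kato_of_codazzi (hD : D.IsMetricCompatible) (hφ : IsTraceFreeSymmField φ)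
    (hx : fieldNorm φ x ≠ 0) (h1 : conformalCodazzi D φ x = 0) (h2 : divergence D φ x = 0) :
    MDifferentiableAt (𝓡 n) 𝓘(ℝ) (fieldNorm φ) x ∧
      diffNormSq n (fieldNorm φ) x ≤
        ((n : ℝ) + m - 1) / ((n : ℝ) + 2 * m) * normSq (covDeriv D φ x) := by
  rw [divergence_eq_zero_iff hφ.smooth] at h2
  rw [conformalCodazzi_eq_zero_iff hφ.smooth, skewTF_of_tr_eq_zero h2] at h1
  have hm : (0 : ℝ) ≤ m := Nat.cast_nonneg m
  refine fieldNorm_kato hD hφ hx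
    (fun hn => div_nonneg (by linarith) (by linarith)) fun ψ hψ h0 ξ => ?_
  have h := kato_of_skew_eq_zero (isTFSTail_covComps hD hφ x) hψ h0 ξ h1 h2
  rwa [card_tangentSpace x] at h

theorem kato_of_killing (hD : D.IsMetricCompatible) (hφ : IsTraceFreeSymmField φ)
    (hx : fieldNorm φ x ≠ 0) (h : symmetrize (covDeriv D φ x) = 0) :
    MDifferentiableAt (𝓡 n) 𝓘(ℝ) (fieldNorm φ) x ∧
      diffNormSq n (fieldNorm φ) x ≤ ((m : ℝ) + 1) / ((m : ℝ) + 2) * normSq (covDeriv D φ x) :=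
  fieldNorm_kato hD hφ hx (fun _ => by positivity) fun _ hψ _ ξ =>
    kato_of_sym_eq_zero hψ ξ ((symmetrize_eq_zero_iff hφ.smooth x).1 h)

theorem kato_of_pureTrace (hD : D.IsMetricCompatible) (hφ : IsTraceFreeSymmField φ)
    (hx : fieldNorm φ x ≠ 0) (h1 : conformalKilling D φ x = 0)
    (h2 : conformalCodazzi D φ x = 0) :
    MDifferentiableAt (𝓡 n) 𝓘(ℝ) (fieldNorm φ) x ∧
      diffNormSq n (fieldNorm φ) x ≤
        ((m : ℝ) + 1) / ((n : ℝ) + 2 * m) * normSq (covDeriv D φ x) := by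
  refine fieldNorm_kato hD hφ hx (fun _ => by positivity) fun ψ hψ h0 ξ => ?_
  have h := kato_of_symTF_skewTF_eq_zero (isTFSTail_covComps hD hφ x) hψ h0 ξ
    ((conformalKilling_eq_zero_iff hφ.smooth x).1 h1)
    ((conformalCodazzi_eq_zero_iff hφ.smooth x).1 h2)
  rwa [card_tangentSpace x] at h

end Cases

end

end KatoTensor

theorem mainTheorem9
    (n : ℕ) (M : Type*) [TopologicalSpace M] [T2Space M] [SecondCountableTopology M]
    [ChartedSpace (EuclideanSpace ℝ (Fin n)) M] [IsManifold (𝓡 n) ∞ M]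
    [RiemannianBundle (fun x : M => TangentSpace (𝓡 n) x)]
    [IsContMDiffRiemannianBundle (𝓡 n) ∞ (EuclideanSpace ℝ (Fin n))
      (fun x : M => TangentSpace (𝓡 n) x)]
    (D : CovariantDerivative (𝓡 n) (EuclideanSpace ℝ (Fin n))
      (fun x : M => TangentSpace (𝓡 n) x))
    (hD : KatoTensor.IsLeviCivita D)
    (k m : ℕ) (hkm : k = m + 1)
    (φ : KatoTensor.TensorField n M (m + 1)) (hφ : KatoTensor.IsTraceFreeSymmField φ) :
    -- trace-free Codazzi tensors
    (((∀ x, KatoTensor.conformalCodazzi D φ x = 0) ∧ (∀ x, KatoTensor.divergence D φ x = 0)) ↔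
      ((∀ x, KatoTensor.skewFirst (KatoTensor.covDeriv D φ x) = 0) ∧
        (k = 1 → ∀ x, KatoTensor.divergence D φ x = 0))) ∧
    ((∀ x, KatoTensor.conformalCodazzi D φ x = 0) → (∀ x, KatoTensor.divergence D φ x = 0) →
      ∀ x, KatoTensor.fieldNorm φ x ≠ 0 →
        MDifferentiableAt (𝓡 n) 𝓘(ℝ) (KatoTensor.fieldNorm φ) x ∧
        KatoTensor.diffNormSq n (KatoTensor.fieldNorm φ) x ≤
          ((n : ℝ) + k - 2) / ((n : ℝ) + 2 * ((k : ℝ) - 1)) *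
            KatoTensor.normSq (KatoTensor.covDeriv D φ x)) ∧
    -- divergence-free conformal Killing tensors
    (((∀ x, KatoTensor.conformalKilling D φ x = 0) ∧ (∀ x, KatoTensor.divergence D φ x = 0)) ↔
      (∀ x, KatoTensor.symmetrize (KatoTensor.covDeriv D φ x) = 0)) ∧
    ((∀ x, KatoTensor.conformalKilling D φ x = 0) → (∀ x, KatoTensor.divergence D φ x = 0) →
      ∀ x, KatoTensor.fieldNorm φ x ≠ 0 →
        MDifferentiableAt (𝓡 n) 𝓘(ℝ) (KatoTensor.fieldNorm φ) x ∧
        KatoTensor.diffNormSq n (KatoTensor.fieldNorm φ) x ≤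
          (k : ℝ) / ((k : ℝ) + 1) *
            KatoTensor.normSq (KatoTensor.covDeriv D φ x)) ∧
    -- tensors whose covariant derivative is pure trace
    (((∀ x, KatoTensor.conformalKilling D φ x = 0) ∧
        (∀ x, KatoTensor.conformalCodazzi D φ x = 0)) ↔
      (∀ x, KatoTensor.IsPureTrace (KatoTensor.covDeriv D φ x))) ∧
    ((∀ x, KatoTensor.conformalKilling D φ x = 0) →
      (∀ x, KatoTensor.conformalCodazzi D φ x = 0) →
      ∀ x, KatoTensor.fieldNorm φ x ≠ 0 →
        MDifferentiableAt (𝓡 n) 𝓘(ℝ) (KatoTensor.fieldNorm φ) x ∧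
        KatoTensor.diffNormSq n (KatoTensor.fieldNorm φ) x ≤
          (k : ℝ) / ((n : ℝ) + 2 * ((k : ℝ) - 1)) *
            KatoTensor.normSq (KatoTensor.covDeriv D φ x)) := by
  subst hkm
  have hc := hD.1
  refine ⟨?_, fun h1 h2 x hx => ?_, ?_, fun h1 h2 x hx => ?_, ?_, fun h1 h2 x hx => ?_⟩
  · have h := fun x => KatoTensor.conformalCodazzi_eq_zero_and_divergence_eq_zero_iff
      (x := x) hc hφ
    exact ⟨fun h0 => ⟨fun x => ((h x).1 ⟨h0.1 x, h0.2 x⟩).1, fun _ => h0.2⟩,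
      fun h0 => forall_and.1 fun x => (h x).2 ⟨h0.1 x, fun hm => h0.2 hm x⟩⟩
  · convert KatoTensor.kato_of_codazzi hc hφ hx (h1 x) (h2 x) using 4 <;> push_cast <;> ring
  · rw [← forall_and]
    exact forall_congr' fun x =>
      KatoTensor.conformalKilling_eq_zero_and_divergence_eq_zero_iff hc hφ
  · convert KatoTensor.kato_of_killing hc hφ hx
      (KatoTensor.conformalKilling_eq_zero_and_divergence_eq_zero_iff hc hφ |>.1
        ⟨h1 x, h2 x⟩) using 4 <;> push_cast <;> ring
  · rw [← forall_and]
    exact forall_congr' fun x => (KatoTensor.isPureTrace_covDeriv_iff hc hφ x).symm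
  · convert KatoTensor.kato_of_pureTrace hc hφ hx (h1 x) (h2 x) using 4 <;> push_cast <;> ring
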